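/- **Setting.** Let $(\Omega,\mathcal A,\mathbb P)$ be a probability space, $E$ a measurable space, and $X=(X_i)_{i\ge1}$ a stationary $E$-valued process. Let $T$ be the shift on $E^{\mathbb N_+}$, and for each $n\ge1$ let $S_n\Phi:E^{\mathbb N_+}\to\mathbb R^d$ be measurable. Let $(k(n))_{n\ge1}$ be an increasing sequence of positive integers. $B(x,r)$ denotes the closed ball of center $x$ and radius $r$. Let $\mu_n$ be the law of $S_n\Phi(X)/n$, and for $\omega\in\Omega$ let $$\mu_n^\omega=\frac1{k(n)}\sum_{j=1}^{k(n)}\delta_{x_{n,j}(\omega)},\qquad x_{n,j}(\omega)=\frac{S_n\Phi(T^{(j-1)n}X(\omega))}{n}.$$ Put $$\Lambda_n(\lambda)=\frac1n\log\int_{\mathbb R^d} e^{n\langle\lambda,x\rangle}\,d\mu_n(x),\qquad \Lambda_n^\omega(\lambda)=\frac1n\log\int_{\mathbb R^d} e^{n\langle\lambda,x\rangle}\,d\mu_n^\omega(x),\qquad \lambda\in\mathbb R^d.$$ Write $\Lambda(\lambda)=\lim_n\Lambda_n(\lambda)$ where the limit exists, and $\Lambda(\lambda)=\limsup_n\Lambda_n(\lambda)\in[-\infty,\infty]$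 in general. Let $\Lambda^*(x)=\sup_{\lambda\in\mathbb R^d}\{\langle\lambda,x\rangle-\Lambda(\lambda)\}$. For sub-$\sigma$-algebras $\mathcal U,\mathcal V$ of $\mathcal A$ let $\alpha(\mathcal U,\mathcal V)=\sup\{|\mathbb P(U)\mathbb P(V)-\mathbb P(U\cap V)|:U\in\mathcal U,V\in\mathcal V\}$. Let $\alpha_{X,0}=1/2$ and, for $m\ge1$, $\alpha_{X,m}=\sup_{i\ge1}\alpha(\sigma(X_k:k\le i),\sigma(X_j:j\ge i+m))$. Let $\alpha_X^{-1}(u)=\inf\{m:\alpha_{X,m}\le u\}$, with $\inf\emptyset=\infty$. **Assumptions.** - (A1') There is an open convex set $\mathcal D\subset\mathbb R^d$ such that for every $\lambda\in\mathcal D$ the limit $\Lambda(\lambda)=\lim_n\Lambda_n(\lambda)$ exists and is finite. - (A2) $\int_0^1(\alpha_X^{-1}(u))^h\,du<\infty$ for all $h>0$. - (A3) There are functions $S_n\Phi_n:E^{\mathbb N_+}\to\mathbb R^d$, each depending only on the first $2n$ coordinates, such that $\sup_{z\in E^{\mathbb N_+}}\|S_n\Phi(z)-S_n\Phi_n(z)\|/n\to0$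 as $n\to\infty$. **Theorem 2.3.** Assume (A1'), (A2) and (A3). Let $\lambda_0\in\mathcal D$ be a point at which $\Lambda$ is differentiable, and let $x_0=\nabla\Lambda(\lambda_0)$. 1. If $\liminf_{n\to\infty}\frac{\log k(n)}n>\Lambda^*(x_0)$, then there is $r>0$ such that $B(\lambda_0,r)\subset\mathcal D$ and, with probability 1, $\Lambda_n^\omega$ converges to $\Lambda$ uniformly on $B(\lambda_0,r)$. 2. If $\liminf_{n\to\infty}\frac{\log k(n)}n>\Lambda^*(x_0)$, then, with probability 1, $$\lim_{\epsilon\to0^+}\liminf_{n\to\infty}\frac1n\log\mu_n^\omega(B(x_0,\epsilon))=\lim_{\epsilon\to0^+}\limsup_{n\to\infty}\frac1n\log\mu_n^\omega(B(x_0,\epsilon))=-\Lambda^*(x_0).$$ If instead $\limsup_{n\to\infty}\frac{\log k(n)}n<\Lambda^*(x_0)$, then there is $\epsilon>0$ such that, with probability 1, for all $n$ large enough the set $\{1\le j\le k(n):x_{n,j}(\omega)\in B(x_0,\epsilon)\}$ is empty. 3. Suppose that $\lim_{n\to\infty}\frac{\log k(n)}n=\Lambda^*(x_0)$ and that $t\in[0,\infty)\mapsto\Lambda(t\lambda_0)$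 is strictly convex at $1$, that is, there is $m\in\mathbb R$ with $\Lambda(t\lambda_0)>\Lambda(\lambda_0)+m(t-1)$ for all $t\ge0$, $t\ne1$. Then, with probability 1, for all $t\ge1$, $$\lim_{n\to\infty}\Lambda_n^\omega(t\lambda_0)=\Lambda(\lambda_0)+(t-1)\langle\lambda_0,x_0\rangle.$$ -/

import Mathlib

open MeasureTheory Filter Topology
open scoped ENNReal

noncomputable section

namespace LocalLDP

/-- The `α`-mixing coefficient of two sub-`σ`-algebras `U`, `V` under `P`:
the supremum of `|P(A) P(B) - P(A ∩ B)|` over `A ∈ U`, `B ∈ V`. -/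
def alphaCoeff {Ω : Type*} [MeasurableSpace Ω] (P : Measure Ω) (U V : MeasurableSpace Ω) : ℝ :=
  sSup {r : ℝ | ∃ A B : Set Ω, MeasurableSet[U] A ∧ MeasurableSet[V] B ∧
    r = |P.real A * P.real B - P.real (A ∩ B)|}

/-- The `σ`-algebra generated by the variables `X i`, `i ∈ I`. -/
abbrev sigmaOf {Ω E : Type*} [mE : MeasurableSpace E] (X : ℕ → Ω → E) (I : Set ℕ) :
    MeasurableSpace Ω :=
  ⨆ i ∈ I, mE.comap (X i)

/-- The Rosenblatt mixing coefficients of the sequence `X` (indexed from `0`):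
`α₀ = 1/2`, and `αₘ = sup_i α(σ(X_k : k ≤ i), σ(X_j : j ≥ i + m))` for `m ≥ 1`. -/
def alphaMixing {Ω E : Type*} [MeasurableSpace Ω] [MeasurableSpace E] (P : Measure Ω)
    (X : ℕ → Ω → E) (m : ℕ) : ℝ :=
  if m = 0 then 1 / 2
  else ⨆ i : ℕ, alphaCoeff P (sigmaOf X (Set.Iic i)) (sigmaOf X (Set.Ici (i + m)))

/-- `α⁻¹(u) = inf {m : αₘ ≤ u}`, with value `∞` when there is no such `m`. -/
def alphaInv {Ω E : Type*} [MeasurableSpace Ω] [MeasurableSpace E] (P : Measure Ω)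
    (X : ℕ → Ω → E) (u : ℝ) : ℝ≥0∞ :=
  ⨅ (m : ℕ) (_ : alphaMixing P X m ≤ u), (m : ℝ≥0∞)

/-- `∫₀¹ (α⁻¹(u))^h du < ∞` for every `h > 0`. -/
def MixingMoments {Ω E : Type*} [MeasurableSpace Ω] [MeasurableSpace E] (P : Measure Ω)
    (X : ℕ → Ω → E) : Prop :=
  ∀ h : ℝ, 0 < h → ∫⁻ u in Set.Icc (0 : ℝ) 1, alphaInv P X u ^ h < ∞

/-- (Strict) stationarity: the law of the whole sequence is invariant under the shift. -/
def Stationary {Ω E : Type*} [MeasurableSpace Ω] [MeasurableSpace E] (P : Measure Ω)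
    (X : ℕ → Ω → E) : Prop :=
  P.map (fun ω i => X (i + 1) ω) = P.map (fun ω i => X i ω)

/-- Uniform approximation: there are functions `S' n` depending only on the first `2n` coordinates
with `sup_z ‖S n z - S' n z‖ / n → 0`. -/
def BlockApproximable {E : Type*} {d : ℕ} (S : ℕ → (ℕ → E) → EuclideanSpace ℝ (Fin d)) : Prop :=
  ∃ S' : ℕ → (ℕ → E) → EuclideanSpace ℝ (Fin d),
    (∀ n, 1 ≤ n → DependsOn (S' n) (Set.Iio (2 * n))) ∧
    Tendsto (fun n : ℕ => (⨆ z : ℕ → E, ‖S n z - S' n z‖ₑ) / (n : ℝ≥0∞)) atTop (𝓝 0)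

/-- The average `S n (T^{jn} x) / n` over the block number `j` (blocks are numbered from `0`),
where `T` is the shift. -/
def blockAvg {E : Type*} {d : ℕ} (S : ℕ → (ℕ → E) → EuclideanSpace ℝ (Fin d))
    (n j : ℕ) (x : ℕ → E) : EuclideanSpace ℝ (Fin d) :=
  (n : ℝ)⁻¹ • S n (fun i => x (j * n + i))

/-- The distribution `μ_n` of `S n (X) / n` under `P`. -/
def avgLaw {Ω E : Type*} [MeasurableSpace Ω] {d : ℕ} (P : Measure Ω) (X : ℕ → Ω → E)
    (S : ℕ → (ℕ → E) → EuclideanSpace ℝ (Fin d)) (n : ℕ) :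
    Measure (EuclideanSpace ℝ (Fin d)) :=
  P.map (fun ω => (n : ℝ)⁻¹ • S n (fun i => X i ω))

/-- The empirical distribution of the first `k n` block averages along the sequence `x`. -/
def empLaw {E : Type*} {d : ℕ} (S : ℕ → (ℕ → E) → EuclideanSpace ℝ (Fin d)) (k : ℕ → ℕ)
    (n : ℕ) (x : ℕ → E) : Measure (EuclideanSpace ℝ (Fin d)) :=
  (k n : ℝ≥0∞)⁻¹ • ∑ j ∈ Finset.range (k n), Measure.dirac (blockAvg S n j x)

/-- `(1/n) log ∫ exp (n ⟨l, x⟩) dμ(x)`, as an extended real number. -/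
def logMGF {d : ℕ} (n : ℕ) (μ : Measure (EuclideanSpace ℝ (Fin d)))
    (l : EuclideanSpace ℝ (Fin d)) : EReal :=
  (((n : ℝ)⁻¹ : ℝ) : EReal) *
    ENNReal.log (∫⁻ x, ENNReal.ofReal (Real.exp ((n : ℝ) * inner ℝ l x)) ∂μ)

/-- `Λ(l) = lim_n Λ_n(l)`. It is taken as an upper limit so as to be an extended real number at
every `l`; it is the limit wherever the limit exists. -/
def limLogMGF {d : ℕ} (μ : ℕ → Measure (EuclideanSpace ℝ (Fin d)))
    (l : EuclideanSpace ℝ (Fin d)) : EReal :=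
  limsup (fun n => logMGF n (μ n) l) atTop

/-- The Fenchel-Legendre transform `L*(x) = sup_l (⟨l, x⟩ - L(l))`. -/
def legendre {d : ℕ} (L : EuclideanSpace ℝ (Fin d) → EReal)
    (x : EuclideanSpace ℝ (Fin d)) : EReal :=
  ⨆ l : EuclideanSpace ℝ (Fin d), ((inner ℝ l x : ℝ) : EReal) - L l

/-- A function `f` on `[0, ∞)` is strictly convex at `a`: some line through `(a, f a)` lies
strictly below the graph of `f` at every point other than `a`. -/
def StrictlyConvexAt (f : ℝ → EReal) (a : ℝ) : Prop :=
  ∃ m : ℝ, ∀ t : ℝ, 0 ≤ t → t ≠ a → f a + ((m * (t - a) : ℝ) : EReal) < f t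

end LocalLDP

end

namespace LocalLDP

/-! ### Exponential rates -/

/-! Convexity of the limiting log-moment generating function puts its tangent hyperplane at `l₀`
below it everywhere, so its Legendre transform at `x₀` is `⟨l₀, x₀⟩ - Λ l₀` (`tangent_le_limLogMGF`,
`legendre_eq`). This number is the critical exponent: about `exp (n Λ* x₀)` blocks are needed to see
one average near `x₀`.

By stationarity the empirical law has mean `avgLaw`, so Markov and Borel–Cantelli bound the
empirical generating function from above at every tilt where the limit exists. The matching lower
bound is the heart of the matter (`ae_eventually_le_sum_of_dependsOn`). Cut off the block variables
`exp (n ⟨l, x⟩)` at a level `b` slightly above `⟨l₀, x₀⟩`. A Chernoff bound at the tilt `(1 + h) l`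
shows that the cut-off barely changes the mean, of rate `a = Λ l`. With more than `exp (n (b - a))`
blocks the second moment method then applies: mixing coefficients decay faster than any power, so at
a separation exponential in `n` they beat every exponential factor in the covariances.

Supercritically this works at all tilts near `l₀`. Almost sure convergence on a countable set
becomes uniform by convexity (`tendstoUniformlyOn_closedBall_of_convexOn`), and a deterministic
local Gärtner–Ellis argument (`eventually_le_measure_closedBall`), applied for each `ω`, gives the
local large deviations. Subcritically a union bound rules out blocks near `x₀`.

At the critical growth, strict convexity makes the tilts `s l₀`, with `s < 1` near `1`,
supercritical (`ae_tendsto_logMGF_empLaw_smul`). Extrapolating their slopes by convexity gives the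
lower bound beyond `l₀`; the absence of blocks with `⟨l₀, x⟩ ≥ ⟨l₀, x₀⟩ + ε` gives the upper one. -/

/-- The exponential rate `(1/n) log I`. -/
noncomputable def expRate (n : ℕ) (I : ℝ≥0∞) : EReal :=
  (((n : ℝ)⁻¹ : ℝ) : EReal) * ENNReal.log I

theorem coe_mul_le_coe_iff {r : ℝ} (hr : 0 < r) (x : EReal) (c : ℝ) :
    ((r⁻¹ : ℝ) : EReal) * x ≤ c ↔ x ≤ ((r * c : ℝ) : EReal) := by
  have hr' : 0 < r⁻¹ := inv_pos.2 hr
  induction x with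
  | bot => simp [EReal.coe_mul_bot_of_pos hr']
  | top => simp [EReal.coe_mul_top_of_pos hr', -EReal.coe_mul]
  | coe x =>
    rw [← EReal.coe_mul, EReal.coe_le_coe_iff, EReal.coe_le_coe_iff, inv_mul_le_iff₀ hr]

theorem coe_le_coe_mul_iff {r : ℝ} (hr : 0 < r) (x : EReal) (c : ℝ) :
    (c : EReal) ≤ ((r⁻¹ : ℝ) : EReal) * x ↔ ((r * c : ℝ) : EReal) ≤ x := by
  have hr' : 0 < r⁻¹ := inv_pos.2 hr
  induction x with
  | bot => simp [EReal.coe_mul_bot_of_pos hr', -EReal.coe_mul]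
  | top => simp [EReal.coe_mul_top_of_pos hr']
  | coe x =>
    rw [← EReal.coe_mul, EReal.coe_le_coe_iff, EReal.coe_le_coe_iff, le_inv_mul_iff₀ hr]

/-- Rates are compared with real constants through exponentials, which keeps the logarithms of `0`
and `∞` out of the later estimates. -/
theorem expRate_le_iff {n : ℕ} (hn : 0 < n) (I : ℝ≥0∞) (c : ℝ) :
    expRate n I ≤ c ↔ I ≤ ENNReal.ofReal (Real.exp (n * c)) := by
  rw [expRate, coe_mul_le_coe_iff (Nat.cast_pos.2 hn), ← ENNReal.log_le_log_iff,
    ENNReal.log_ofReal_of_pos (Real.exp_pos _), Real.log_exp]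

theorem le_expRate_iff {n : ℕ} (hn : 0 < n) (I : ℝ≥0∞) (c : ℝ) :
    (c : EReal) ≤ expRate n I ↔ ENNReal.ofReal (Real.exp (n * c)) ≤ I := by
  rw [expRate, coe_le_coe_mul_iff (Nat.cast_pos.2 hn), ← ENNReal.log_le_log_iff,
    ENNReal.log_ofReal_of_pos (Real.exp_pos _), Real.log_exp]

theorem expRate_ofReal {n : ℕ} {x : ℝ} (hx : 0 < x) :
    expRate n (ENNReal.ofReal x) = (((n : ℝ)⁻¹ * Real.log x : ℝ) : EReal) := by
  rw [expRate, ENNReal.log_ofReal_of_pos hx, EReal.coe_mul]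

theorem logMGF_eq_expRate {d : ℕ} (n : ℕ) (μ : Measure (EuclideanSpace ℝ (Fin d)))
    (l : EuclideanSpace ℝ (Fin d)) :
    logMGF n μ l =
      expRate n (∫⁻ x, ENNReal.ofReal (Real.exp ((n : ℝ) * inner ℝ l x)) ∂μ) := rfl

theorem ereal_tendsto_coe_iff {ι : Type*} {F : Filter ι} {u : ι → EReal} {a : ℝ} :
    Tendsto u F (𝓝 (a : EReal)) ↔ ∀ δ : ℝ, 0 < δ →
      (∀ᶠ i in F, ((a - δ : ℝ) : EReal) ≤ u i) ∧ ∀ᶠ i in F, u i ≤ ((a + δ : ℝ) : EReal) := by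
  constructor
  · intro h δ hδ
    constructor
    · exact (h.eventually (lt_mem_nhds (EReal.coe_lt_coe_iff.2 (by linarith)))).mono
        fun _ h => h.le
    · exact (h.eventually (gt_mem_nhds (EReal.coe_lt_coe_iff.2 (by linarith)))).mono
        fun _ h => h.le
  · intro h
    rw [tendsto_order]
    constructor
    · intro b hb
      obtain ⟨c, hbc, hca⟩ := EReal.lt_iff_exists_real_btwn.1 hb
      have hca' := EReal.coe_lt_coe_iff.1 hca
      filter_upwards [(h (a - c) (by linarith)).1] with i hi
      exact hbc.trans_le (by simpa using hi)
    · intro b hb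
      obtain ⟨c, hac, hcb⟩ := EReal.lt_iff_exists_real_btwn.1 hb
      have hac' := EReal.coe_lt_coe_iff.1 hac
      filter_upwards [(h (c - a) (by linarith)).2] with i hi
      exact lt_of_le_of_lt (by simpa using hi) hcb

/-- Hölder's inequality: `l ↦ logMGF n μ l` is convex. -/
theorem logMGF_convex_le {d : ℕ} {n : ℕ} (hn : 0 < n) (μ : Measure (EuclideanSpace ℝ (Fin d)))
    {l₁ l₂ : EuclideanSpace ℝ (Fin d)} {c₁ c₂ a b : ℝ} (ha : 0 ≤ a) (hb : 0 ≤ b)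
    (hab : a + b = 1) (h₁ : logMGF n μ l₁ ≤ c₁) (h₂ : logMGF n μ l₂ ≤ c₂) :
    logMGF n μ (a • l₁ + b • l₂) ≤ ((a * c₁ + b * c₂ : ℝ) : EReal) := by
  rw [logMGF_eq_expRate, expRate_le_iff hn] at *
  have key := ENNReal.lintegral_mul_norm_pow_le (μ := μ)
    (f := fun x => ENNReal.ofReal (Real.exp ((n : ℝ) * inner ℝ l₁ x)))
    (g := fun x => ENNReal.ofReal (Real.exp ((n : ℝ) * inner ℝ l₂ x)))
    (by fun_prop) (by fun_prop) ha hb hab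
  have e : ∀ u v : ℝ, ENNReal.ofReal (Real.exp u) ^ a * ENNReal.ofReal (Real.exp v) ^ b
      = ENNReal.ofReal (Real.exp (u * a + v * b)) := by
    intro u v
    rw [ENNReal.ofReal_rpow_of_pos (Real.exp_pos _), ENNReal.ofReal_rpow_of_pos (Real.exp_pos _),
      ← ENNReal.ofReal_mul (by positivity), ← Real.exp_mul, ← Real.exp_mul, ← Real.exp_add]
  calc _ = ∫⁻ x, ENNReal.ofReal (Real.exp ((n : ℝ) * inner ℝ l₁ x)) ^ a *
        ENNReal.ofReal (Real.exp ((n : ℝ) * inner ℝ l₂ x)) ^ b ∂μ := by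
        refine lintegral_congr fun x => ?_
        rw [e, inner_add_left, real_inner_smul_left, real_inner_smul_left]
        congr 2; ring
    _ ≤ _ := key
    _ ≤ ENNReal.ofReal (Real.exp (n * c₁)) ^ a * ENNReal.ofReal (Real.exp (n * c₂)) ^ b := by
        gcongr
    _ = _ := by rw [e]; congr 2; ring

theorem lintegral_empLaw {E : Type*} {d : ℕ} (S : ℕ → (ℕ → E) → EuclideanSpace ℝ (Fin d))
    (k : ℕ → ℕ) (n : ℕ) (x : ℕ → E) (f : EuclideanSpace ℝ (Fin d) → ℝ≥0∞) :
    ∫⁻ y, f y ∂(empLaw S k n x) =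
      (k n : ℝ≥0∞)⁻¹ * ∑ j ∈ Finset.range (k n), f (blockAvg S n j x) := by
  rw [empLaw, lintegral_smul_measure, lintegral_finsetSum_measure]
  simp [lintegral_dirac]

theorem expRate_tendsto_iff {I : ℕ → ℝ≥0∞} {a : ℝ} :
    Tendsto (fun n => expRate n (I n)) atTop (𝓝 (a : EReal)) ↔ ∀ δ : ℝ, 0 < δ →
      (∀ᶠ n : ℕ in atTop, ENNReal.ofReal (Real.exp (n * (a - δ))) ≤ I n) ∧
        ∀ᶠ n : ℕ in atTop, I n ≤ ENNReal.ofReal (Real.exp (n * (a + δ))) := by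
  rw [ereal_tendsto_coe_iff]
  refine forall₂_congr fun δ _ => and_congr ?_ ?_
  · exact eventually_congr ((eventually_gt_atTop 0).mono fun n hn => le_expRate_iff hn _ _)
  · exact eventually_congr ((eventually_gt_atTop 0).mono fun n hn => expRate_le_iff hn _ _)

/-- Borel–Cantelli for exponentially small events. -/
theorem ae_eventually_notMem_of_exp {Ω : Type*} [MeasurableSpace Ω] {P : Measure Ω}
    {s : ℕ → Set Ω} {C η : ℝ} (hη : 0 < η)
    (h : ∀ᶠ n : ℕ in atTop, P (s n) ≤ ENNReal.ofReal (C * Real.exp (-(n * η)))) :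
    ∀ᵐ ω ∂P, ∀ᶠ n in atTop, ω ∉ s n := by
  obtain ⟨N, hN⟩ := eventually_atTop.1 h
  have hsum : Summable fun n : ℕ => |C| * Real.exp (-(n * η)) := by
    refine Summable.mul_left _ ?_
    have := Real.summable_exp_nat_mul_iff (a := -η)
    simpa using this.2 (by linarith)
  have : ∑' n, P (if N ≤ n then s n else ∅) ≠ ∞ := by
    refine ne_top_of_le_ne_top hsum.tsum_ofReal_ne_top (ENNReal.tsum_le_tsum fun n => ?_)
    split_ifs with hn
    · refine (hN n hn).trans (ENNReal.ofReal_le_ofReal ?_)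
      gcongr
      exact le_abs_self _
    · simp
  filter_upwards [ae_eventually_notMem this] with ω hω
  filter_upwards [hω, eventually_ge_atTop N] with n hn hNn
  simpa [hNn] using hn

/-- If an exponential moment of `I` has rate at most `a`, then almost surely so does `I`. -/
theorem ae_eventually_le_of_lintegral_le {Ω : Type*} [MeasurableSpace Ω] {P : Measure Ω}
    {I : ℕ → Ω → ℝ≥0∞} {a : ℝ}
    (h : ∀ δ : ℝ, 0 < δ → ∀ᶠ n : ℕ in atTop,
      ∫⁻ ω, I n ω ∂P ≤ ENNReal.ofReal (Real.exp (n * (a + δ))))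
    (hI : ∀ᶠ n in atTop, AEMeasurable (I n) P) :
    ∀ᵐ ω ∂P, ∀ δ : ℝ, 0 < δ → ∀ᶠ n : ℕ in atTop,
      I n ω ≤ ENNReal.ofReal (Real.exp (n * (a + δ))) := by
  have main : ∀ m : ℕ, ∀ᵐ ω ∂P, ∀ᶠ n : ℕ in atTop,
      I n ω ≤ ENNReal.ofReal (Real.exp (n * (a + 1 / (m + 1)))) := by
    intro m
    have hm : (0 : ℝ) < 1 / (m + 1) := by positivity
    -- Markov at rate `a + 1/(m+1)` against a mean of rate `a` plus half of `1/(m+1)` leaves the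
    -- other half as exponential decay.
    have := ae_eventually_notMem_of_exp (P := P) (C := 1) (η := (1 / (m + 1) : ℝ) / 2)
      (s := fun n => {ω | ENNReal.ofReal (Real.exp (n * (a + 1 / (m + 1)))) ≤ I n ω})
      (by positivity) (by
        filter_upwards [h _ (half_pos hm), hI] with n hn hIn
        have hne : ENNReal.ofReal (Real.exp (n * (a + 1 / (m + 1)))) ≠ 0 := by
          simpa using Real.exp_pos _
        refine (meas_ge_le_lintegral_div hIn hne ENNReal.ofReal_ne_top).trans ?_
        refine (ENNReal.div_le_div_right hn _).trans ?_
        rw [← ENNReal.ofReal_div_of_pos (Real.exp_pos _), ← Real.exp_sub]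
        refine ENNReal.ofReal_le_ofReal (le_of_eq ?_)
        rw [one_mul]; congr 1; ring)
    filter_upwards [this] with ω hω
    filter_upwards [hω] with n hn
    exact (not_le.1 hn).le
  filter_upwards [ae_all_iff.2 main] with ω hω δ hδ
  obtain ⟨m, hm⟩ := exists_nat_one_div_lt hδ
  filter_upwards [hω m] with n hn
  refine hn.trans (ENNReal.ofReal_le_ofReal (Real.exp_le_exp.2 ?_))
  gcongr

/-! ### Mixing coefficients and covariances -/

theorem abs_sub_le_one_of_prob {Ω : Type*} [MeasurableSpace Ω] (P : Measure Ω)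
    [IsProbabilityMeasure P] (A B : Set Ω) :
    |P.real A * P.real B - P.real (A ∩ B)| ≤ 1 := by
  have h1 : P.real A ≤ 1 := measureReal_le_one
  have h2 : P.real B ≤ 1 := measureReal_le_one
  have h3 : P.real (A ∩ B) ≤ 1 := measureReal_le_one
  have h4 : 0 ≤ P.real A := measureReal_nonneg
  have h5 : 0 ≤ P.real B := measureReal_nonneg
  have h6 : 0 ≤ P.real (A ∩ B) := measureReal_nonneg
  rw [abs_le]
  constructor <;> nlinarith

theorem le_alphaCoeff {Ω : Type*} {U V : MeasurableSpace Ω} [MeasurableSpace Ω] (P : Measure Ω)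
    [IsProbabilityMeasure P] {A B : Set Ω} (hA : MeasurableSet[U] A) (hB : MeasurableSet[V] B) :
    |P.real A * P.real B - P.real (A ∩ B)| ≤ alphaCoeff P U V :=
  le_csSup ⟨1, by rintro _ ⟨A, B, -, -, rfl⟩; exact abs_sub_le_one_of_prob P A B⟩
    ⟨A, B, hA, hB, rfl⟩

theorem alphaCoeff_le_one {Ω : Type*} (U V : MeasurableSpace Ω) [MeasurableSpace Ω]
    (P : Measure Ω) [IsProbabilityMeasure P] : alphaCoeff P U V ≤ 1 := by
  refine Real.sSup_le ?_ zero_le_one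
  rintro _ ⟨A, B, -, -, rfl⟩
  exact abs_sub_le_one_of_prob P A B

theorem sigmaOf_mono {Ω E : Type*} [MeasurableSpace E] (X : ℕ → Ω → E) {I J : Set ℕ} (h : I ⊆ J) : sigmaOf X I ≤ sigmaOf X J :=
  biSup_mono h

theorem measurable_sigmaOf {Ω E : Type*} [MeasurableSpace E] (X : ℕ → Ω → E) {I : Set ℕ} {i : ℕ}
    (hi : i ∈ I) : Measurable[sigmaOf X I] (X i) :=
  (comap_measurable (X i)).mono (le_iSup₂_of_le i hi le_rfl) le_rfl

section

variable {Ω E : Type*} [MeasurableSpace Ω] [MeasurableSpace E] (P : Measure Ω)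
  [IsProbabilityMeasure P] (X : ℕ → Ω → E)

theorem alphaMixing_le_one (m : ℕ) : alphaMixing P X m ≤ 1 := by
  rw [alphaMixing]
  split_ifs
  · norm_num
  · exact Real.iSup_le (fun i => alphaCoeff_le_one _ _ P) zero_le_one

theorem le_alphaMixing {m : ℕ} (hm : m ≠ 0) (i : ℕ) {A B : Set Ω}
    (hA : MeasurableSet[sigmaOf X (Set.Iic i)] A)
    (hB : MeasurableSet[sigmaOf X (Set.Ici (i + m))] B) :
    |P.real A * P.real B - P.real (A ∩ B)| ≤ alphaMixing P X m := by
  rw [alphaMixing, if_neg hm]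
  refine (le_alphaCoeff P hA hB).trans ?_
  exact le_ciSup (f := fun i : ℕ => alphaCoeff P (sigmaOf X (Set.Iic i)) (sigmaOf X (Set.Ici (i + m))))
    ⟨1, by rintro _ ⟨j, rfl⟩; exact alphaCoeff_le_one _ _ P⟩ i

theorem sigmaOf_le (hX : ∀ i, Measurable (X i)) (I : Set ℕ) :
    sigmaOf X I ≤ (inferInstance : MeasurableSpace Ω) :=
  iSup₂_le fun i _ => (hX i).comap_le

/-- A larger gap shrinks the future `σ`-algebra. Index `0` is left out because its value `1/2` is a
convention, not a supremum. -/
theorem alphaMixing_anti {m m' : ℕ} (hm : m ≠ 0) (h : m ≤ m') :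
    alphaMixing P X m' ≤ alphaMixing P X m := by
  rw [alphaMixing, if_neg (by omega)]
  refine ciSup_le fun i => ?_
  refine Real.sSup_le ?_ ?_
  · rintro _ ⟨A, B, hA, hB, rfl⟩
    exact le_alphaMixing P X hm i hA (sigmaOf_mono X (Set.Ici_subset_Ici.2 (by omega)) _ hB)
  · exact (abs_nonneg _).trans (le_alphaMixing P X hm i
      (@MeasurableSet.empty _ (_)) (@MeasurableSet.empty _ (_)))

/-- By monotonicity no index `1 ≤ j < m` qualifies in the infimum; the bound `u < 1/2` disposes of
`j = 0`. -/
theorem le_alphaInv {m : ℕ} {u : ℝ} (h : u < alphaMixing P X m) (hu : u < 1 / 2) :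
    (m : ℝ≥0∞) ≤ alphaInv P X u := by
  refine le_iInf₂ fun j hj => ?_
  rw [Nat.cast_le]
  by_contra! hjm
  rcases eq_or_ne j 0 with rfl | h0
  · rw [alphaMixing, if_pos rfl] at hj
    linarith
  · exact absurd (alphaMixing_anti P X h0 hjm.le) (by linarith)

/-- The moment condition on `α⁻¹` forces the mixing coefficients to decay faster than any power. -/
theorem MixingMoments.exists_bound {P : Measure Ω} [IsProbabilityMeasure P] {X : ℕ → Ω → E}
    (h : MixingMoments P X) (H : ℕ) (hH : 0 < H) :
    ∃ C : ℝ, 0 ≤ C ∧ ∀ m : ℕ, 0 < m → alphaMixing P X m * (m : ℝ) ^ H ≤ C := by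
  have hfin := h H (Nat.cast_pos.2 hH)
  set J := ∫⁻ u in Set.Icc (0 : ℝ) 1, alphaInv P X u ^ (H : ℝ) with hJ
  refine ⟨2 * J.toReal, by positivity, fun m hm => ?_⟩
  have hmpos : (0 : ℝ) < (m : ℝ) ^ H := by positivity
  -- The integrand is at least `m ^ H` on the interval from `0` to this minimum. Since the
  -- coefficients are at most `1`, they are at most twice the minimum, whence the constant `2 * J`.
  have key : min (alphaMixing P X m) (1 / 2) * (m : ℝ) ^ H ≤ J.toReal := by
    set c := min (alphaMixing P X m) (1 / 2) with hc
    rcases le_or_gt c 0 with hc0 | hc0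
    · exact (mul_nonpos_of_nonpos_of_nonneg hc0 hmpos.le).trans ENNReal.toReal_nonneg
    rw [← ENNReal.ofReal_le_iff_le_toReal hfin.ne]
    calc ENNReal.ofReal (c * (m : ℝ) ^ H)
        = ∫⁻ u in Set.Ioo (0 : ℝ) c, (m : ℝ≥0∞) ^ (H : ℝ) := by
          rw [setLIntegral_const, Real.volume_Ioo, sub_zero, mul_comm c,
            ENNReal.ofReal_mul hmpos.le, ENNReal.ofReal_pow (Nat.cast_nonneg _),
            ENNReal.ofReal_natCast, ENNReal.rpow_natCast]
      _ ≤ ∫⁻ u in Set.Ioo (0 : ℝ) c, alphaInv P X u ^ (H : ℝ) := by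
          refine setLIntegral_mono' measurableSet_Ioo fun u hu => ?_
          gcongr
          exact le_alphaInv P X (hu.2.trans_le (min_le_left _ _)) (hu.2.trans_le (min_le_right _ _))
      _ ≤ J := by
          refine lintegral_mono_set fun u hu => ⟨hu.1.le, ?_⟩
          have := hu.2.trans_le (min_le_right _ _)
          linarith
  have hα := alphaMixing_le_one P X m
  rcases le_total (alphaMixing P X m) (1 / 2) with h1 | h1
  · rw [min_eq_left h1] at key
    nlinarith [ENNReal.toReal_nonneg (a := J)]
  · rw [min_eq_right h1] at key
    nlinarith

end

/-- If two finite measures differ by at most `c` on a sub-`σ`-algebra, the integrals of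
a `[0, M]`-valued function measurable for it differ by at most `M * c`. -/
theorem integral_sub_le_of_measure_sub_le {Ω : Type*} {U mΩ : MeasurableSpace Ω}
    {ν₁ ν₂ : Measure Ω} [IsFiniteMeasure ν₁] [IsFiniteMeasure ν₂]
    (hU : U ≤ mΩ) {c M : ℝ} (hM : 0 ≤ M)
    (h : ∀ A, MeasurableSet[U] A → |ν₁.real A - ν₂.real A| ≤ c) {Z : Ω → ℝ}
    (hZ : Measurable[U] Z) (hZ0 : ∀ ω, 0 ≤ Z ω) (hZM : ∀ ω, Z ω ≤ M) :
    |∫ ω, Z ω ∂ν₁ - ∫ ω, Z ω ∂ν₂| ≤ M * c := by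
  have hZ' : Measurable Z := hZ.mono hU le_rfl
  have hint : ∀ ν : Measure Ω, IsFiniteMeasure ν → Integrable Z ν := fun ν _ =>
    Integrable.of_bound hZ'.aestronglyMeasurable M
      (Eventually.of_forall fun ω => by rw [Real.norm_of_nonneg (hZ0 ω)]; exact hZM ω)
  -- Layer cake: the superlevel sets belong to `U`, so the two integrands in `t` differ by at most
  -- `c` on an interval of length `M`.
  have hlayer : ∀ ν : Measure Ω, IsFiniteMeasure ν →
      ∫ ω, Z ω ∂ν = ∫ t in Set.Ioc 0 M, ν.real {a | t ≤ Z a} := fun ν hν =>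
    (hint ν hν).integral_eq_integral_Ioc_meas_le (Eventually.of_forall hZ0)
      (Eventually.of_forall hZM)
  have hanti : ∀ ν : Measure Ω, IsFiniteMeasure ν →
      IntegrableOn (fun t => ν.real {a | t ≤ Z a}) (Set.Ioc 0 M) := fun ν hν => by
    refine (AntitoneOn.integrableOn_isCompact (isCompact_Icc (a := (0 : ℝ)) (b := M)) ?_).mono_set
      Set.Ioc_subset_Icc_self
    intro s _ t _ hst
    exact measureReal_mono fun a (ha : t ≤ Z a) => hst.trans ha
  rw [hlayer ν₁ inferInstance, hlayer ν₂ inferInstance,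
    ← integral_sub (hanti ν₁ inferInstance) (hanti ν₂ inferInstance), ← Real.norm_eq_abs]
  refine (norm_setIntegral_le_of_norm_le_const (C := c) (by simp) fun t _ => ?_).trans ?_
  · exact h _ (hZ (measurableSet_Ici (a := t)))
  · simp [hM, mul_comm]

/-- The covariance inequality for bounded variables under strong mixing. -/
theorem integral_mul_le_of_mixing {Ω : Type*} {U V mΩ : MeasurableSpace Ω}
    {P : Measure Ω} [IsProbabilityMeasure P]
    (hU : U ≤ mΩ) (hV : V ≤ mΩ) {c M : ℝ} (hM : 0 ≤ M)
    (h : ∀ A B, MeasurableSet[U] A → MeasurableSet[V] B →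
      |P.real A * P.real B - P.real (A ∩ B)| ≤ c) {Z W : Ω → ℝ}
    (hZ : Measurable[U] Z) (hZ0 : ∀ ω, 0 ≤ Z ω) (hZM : ∀ ω, Z ω ≤ M)
    (hW : Measurable[V] W) (hW0 : ∀ ω, 0 ≤ W ω) (hWM : ∀ ω, W ω ≤ M) :
    ∫ ω, Z ω * W ω ∂P ≤ (∫ ω, Z ω ∂P) * (∫ ω, W ω ∂P) + M ^ 2 * c := by
  have hZ' : Measurable Z := hZ.mono hU le_rfl
  have hZint : Integrable Z P := Integrable.of_bound hZ'.aestronglyMeasurable M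
      (Eventually.of_forall fun ω => by rw [Real.norm_of_nonneg (hZ0 ω)]; exact hZM ω)
  have hEZ0 : 0 ≤ ∫ ω, Z ω ∂P := integral_nonneg hZ0
  -- The layer-cake comparison is used twice: here for `Z` with `B` frozen, comparing `P` restricted
  -- to `B` with `P(B) P`; then for `W`, comparing `Z P` with `E[Z] P`. Each pass costs a factor
  -- `M`.
  have step1 : ∀ B, MeasurableSet[V] B →
      |∫ ω in B, Z ω ∂P - P.real B * ∫ ω, Z ω ∂P| ≤ M * c := by
    intro B hB
    have hfin : IsFiniteMeasure (ENNReal.ofReal (P.real B) • P) :=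
      P.smul_finite ENNReal.ofReal_ne_top
    have := integral_sub_le_of_measure_sub_le (ν₁ := P.restrict B)
      (ν₂ := ENNReal.ofReal (P.real B) • P) hU hM (c := c) (fun A hA => ?_) hZ hZ0 hZM
    · rwa [integral_smul_measure, ENNReal.toReal_ofReal measureReal_nonneg, smul_eq_mul] at this
    · rw [measureReal_restrict_apply (hU _ hA), measureReal_ennreal_smul_apply,
        ENNReal.toReal_ofReal measureReal_nonneg, abs_sub_comm, mul_comm]
      exact h A B hA hB
  set ν := P.withDensity fun ω => ENNReal.ofReal (Z ω) with hν
  have hνfin : IsFiniteMeasure ν := isFiniteMeasure_withDensity_ofReal hZint.2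
  have hνreal : ∀ B, MeasurableSet B → ν.real B = ∫ ω in B, Z ω ∂P := by
    intro B hB
    rw [Measure.real, hν, withDensity_apply _ hB,
      integral_eq_lintegral_of_nonneg_ae (Eventually.of_forall hZ0) hZ'.aestronglyMeasurable]
  have hfin : IsFiniteMeasure (ENNReal.ofReal (∫ ω, Z ω ∂P) • P) :=
    P.smul_finite ENNReal.ofReal_ne_top
  have step2 := integral_sub_le_of_measure_sub_le (ν₁ := ν)
      (ν₂ := ENNReal.ofReal (∫ ω, Z ω ∂P) • P) hV hM (c := M * c) (fun B hB => by
        rw [hνreal B (hV _ hB), measureReal_ennreal_smul_apply, ENNReal.toReal_ofReal hEZ0, mul_comm (∫ ω, Z ω ∂P)]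
        exact step1 B hB) hW hW0 hWM
  rw [integral_smul_measure, ENNReal.toReal_ofReal hEZ0, smul_eq_mul, hν,
    integral_withDensity_eq_integral_toReal_smul (by fun_prop)
      (Eventually.of_forall fun _ => ENNReal.ofReal_lt_top)] at step2
  simp only [ENNReal.toReal_ofReal (hZ0 _), smul_eq_mul] at step2
  have := (abs_le.1 step2).2
  nlinarith

theorem card_filter_abs_sub_lt (K L i : ℕ) :
    ((Finset.range K).filter fun j => j < i + L ∧ i < j + L).card ≤ 2 * L := by
  calc _ ≤ (Finset.Ico (i - L) (i + L)).card := by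
        refine Finset.card_le_card fun j hj => ?_
        simp only [Finset.mem_filter, Finset.mem_range, Finset.mem_Ico] at hj ⊢
        omega
    _ ≤ 2 * L := by rw [Nat.card_Ico]; omega

/-- A second moment bound for sums of nonnegative bounded variables which are nearly
uncorrelated at distance at least `L`. -/
theorem integral_sum_sub_sq_le {Ω : Type*} [MeasurableSpace Ω] {P : Measure Ω}
    [IsProbabilityMeasure P] {Z : ℕ → Ω → ℝ} {M p c : ℝ} (hc : 0 ≤ c)
    (hZm : ∀ j, Measurable (Z j)) (hZ0 : ∀ j ω, 0 ≤ Z j ω) (hZM : ∀ j ω, Z j ω ≤ M)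
    (hp : ∀ j, ∫ ω, Z j ω ∂P = p) (K L : ℕ)
    (hcov : ∀ i j, i + L ≤ j → ∫ ω, Z i ω * Z j ω ∂P ≤ p ^ 2 + c) :
    ∫ ω, (∑ j ∈ Finset.range K, Z j ω - K * p) ^ 2 ∂P ≤
      K * (2 * L) * (M * p) + (K : ℝ) ^ 2 * c := by
  have hint : ∀ j, Integrable (Z j) P := fun j => Integrable.of_bound
    (hZm j).aestronglyMeasurable M (Eventually.of_forall fun ω => by
      rw [Real.norm_of_nonneg (hZ0 j ω)]; exact hZM j ω)
  have hmul : ∀ i j, Integrable (fun ω => Z i ω * Z j ω) P := fun i j =>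
    (hint j).bdd_mul (c := M) (hZm i).aestronglyMeasurable (Eventually.of_forall fun ω => by
      rw [Real.norm_of_nonneg (hZ0 i ω)]; exact hZM i ω)
  have hp0 : 0 ≤ p := hp 0 ▸ integral_nonneg (hZ0 0)
  have hM0 : 0 ≤ M := by
    obtain ⟨ω⟩ := P.nonempty_of_neZero
    exact (hZ0 0 ω).trans (hZM 0 ω)
  -- For close pairs one factor is bounded by `M`, leaving `M * p`, which is much better than `M ^
  -- 2` when `p` is small; distant pairs use the covariance hypothesis.
  have hcross : ∀ i j, ∫ ω, Z i ω * Z j ω ∂P - p ^ 2 ≤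
      c + if j < i + L ∧ i < j + L then M * p else 0 := by
    intro i j
    split_ifs with hij
    · have : ∫ ω, Z i ω * Z j ω ∂P ≤ M * p := by
        rw [← hp j, ← integral_const_mul]
        exact integral_mono (hmul i j) ((hint j).const_mul M) fun ω =>
          mul_le_mul_of_nonneg_right (hZM i ω) (hZ0 j ω)
      nlinarith [sq_nonneg p]
    · rcases not_and_or.1 hij with h | h
      · linarith [hcov i j (not_lt.1 h)]
      · have := hcov j i (not_lt.1 h)
        simp_rw [mul_comm (Z j _)] at this
        linarith
  have hexp : ∀ ω, (∑ j ∈ Finset.range K, Z j ω - K * p) ^ 2 =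
      ∑ i ∈ Finset.range K, ∑ j ∈ Finset.range K,
        (Z i ω * Z j ω - p * Z i ω - p * Z j ω + p ^ 2) := by
    intro ω
    have : ∑ j ∈ Finset.range K, Z j ω - K * p = ∑ j ∈ Finset.range K, (Z j ω - p) := by
      simp [Finset.sum_sub_distrib]
    rw [this, sq, Finset.sum_mul_sum]
    refine Finset.sum_congr rfl fun i _ => Finset.sum_congr rfl fun j _ => by ring
  have hterm : ∀ i j, Integrable (fun ω => Z i ω * Z j ω - p * Z i ω - p * Z j ω + p ^ 2) P :=
    fun i j => (((hmul i j).sub ((hint i).const_mul p)).sub ((hint j).const_mul p)).add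
      (integrable_const _)
  have hval : ∀ i j, ∫ ω, (Z i ω * Z j ω - p * Z i ω - p * Z j ω + p ^ 2) ∂P =
      ∫ ω, Z i ω * Z j ω ∂P - p ^ 2 := by
    intro i j
    have h1 : Integrable (fun ω => Z i ω * Z j ω - p * Z i ω) P :=
      (hmul i j).sub ((hint i).const_mul p)
    have h2 : Integrable (fun ω => Z i ω * Z j ω - p * Z i ω - p * Z j ω) P :=
      h1.sub ((hint j).const_mul p)
    rw [integral_add h2 (integrable_const _), integral_sub h1 ((hint j).const_mul p),
      integral_sub (hmul i j) ((hint i).const_mul p), integral_const_mul, integral_const_mul, hp, hp]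
    simp
    ring
  simp_rw [hexp]
  rw [integral_finsetSum _ fun i _ => integrable_finsetSum _ fun j _ => hterm i j]
  simp_rw [integral_finsetSum _ fun j _ => hterm _ j, hval]
  calc _ ≤ ∑ i ∈ Finset.range K, ∑ j ∈ Finset.range K,
        (c + if j < i + L ∧ i < j + L then M * p else 0) :=
        Finset.sum_le_sum fun i _ => Finset.sum_le_sum fun j _ => hcross i j
    _ ≤ ∑ i ∈ Finset.range K, (K * c + (2 * L : ℕ) * (M * p)) := by
        refine Finset.sum_le_sum fun i _ => ?_
        rw [Finset.sum_add_distrib, ← Finset.sum_filter, Finset.sum_const, Finset.sum_const,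
          Finset.card_range, nsmul_eq_mul, nsmul_eq_mul]
        gcongr
        exact card_filter_abs_sub_lt K L i
    _ = _ := by
        rw [Finset.sum_const, Finset.card_range, nsmul_eq_mul]
        push_cast
        ring

/-- Chebyshev's inequality for the lower deviations of such sums. -/
theorem measure_sum_le_half {Ω : Type*} [MeasurableSpace Ω] {P : Measure Ω}
    [IsProbabilityMeasure P] {Z : ℕ → Ω → ℝ} {M p c : ℝ} (hc : 0 ≤ c)
    (hZm : ∀ j, Measurable (Z j)) (hZ0 : ∀ j ω, 0 ≤ Z j ω) (hZM : ∀ j ω, Z j ω ≤ M)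
    (hp : ∀ j, ∫ ω, Z j ω ∂P = p) {K : ℕ} (L : ℕ)
    (hcov : ∀ i j, i + L ≤ j → ∫ ω, Z i ω * Z j ω ∂P ≤ p ^ 2 + c) (hK : 0 < K) (hp0 : 0 < p) :
    P {ω | ∑ j ∈ Finset.range K, Z j ω ≤ K * p / 2} ≤
      ENNReal.ofReal (8 * L * (M / (K * p)) + 4 * c / p ^ 2) := by
  have hKp : (0 : ℝ) < K * p := by positivity
  have hvar := integral_sum_sub_sq_le hc hZm hZ0 hZM hp K L hcov
  have hmeas : Measurable fun ω => ∑ j ∈ Finset.range K, Z j ω :=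
    Finset.measurable_fun_sum _ fun j _ => hZm j
  have hint : Integrable (fun ω => (∑ j ∈ Finset.range K, Z j ω - K * p) ^ 2) P := by
    refine Integrable.of_bound (C := (K * M + K * p) ^ 2) (by fun_prop)
      (Eventually.of_forall fun ω => ?_)
    rw [norm_pow, Real.norm_eq_abs]
    have h0 : 0 ≤ ∑ j ∈ Finset.range K, Z j ω := Finset.sum_nonneg fun j _ => hZ0 j ω
    have h1 : ∑ j ∈ Finset.range K, Z j ω ≤ K * M := by
      simpa using Finset.sum_le_card_nsmul (Finset.range K) _ M fun j _ => hZM j ω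
    gcongr
    rw [abs_le]
    constructor <;> linarith
  -- Falling below half the mean is a deviation of at least `K p / 2`; dividing the second moment
  -- bound by its square produces the constants `8` and `4`.
  have hcheb := mul_meas_ge_le_integral_of_nonneg
    (Eventually.of_forall fun ω => sq_nonneg (∑ j ∈ Finset.range K, Z j ω - K * p)) hint
    ((K * p / 2) ^ 2)
  have hsub : P.real {ω | ∑ j ∈ Finset.range K, Z j ω ≤ K * p / 2} ≤
      P.real {ω | (K * p / 2) ^ 2 ≤ (∑ j ∈ Finset.range K, Z j ω - K * p) ^ 2} := by
    refine measureReal_mono fun ω hω => ?_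
    simp only [Set.mem_ofPred_eq] at hω ⊢
    nlinarith
  rw [← ENNReal.ofReal_toReal (measure_ne_top P _)]
  refine ENNReal.ofReal_le_ofReal (hsub.trans ?_)
  have h3 : (K * p / 2) ^ 2 * P.real {ω | (K * p / 2) ^ 2 ≤
      (∑ j ∈ Finset.range K, Z j ω - K * p) ^ 2} ≤
      K * (2 * L) * (M * p) + (K : ℝ) ^ 2 * c := hcheb.trans hvar
  rw [← le_div_iff₀' (by positivity)] at h3
  refine h3.trans (le_of_eq ?_)
  have : (K : ℝ) ≠ 0 := by positivity
  field_simp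
  ring

/-! ### A law of large numbers for exponential block sums -/

section

variable {Ω E : Type*} [MeasurableSpace Ω] [MeasurableSpace E] {P : Measure Ω} {X : ℕ → Ω → E}

theorem Stationary.map_shift (hX : Stationary P X) (hXm : ∀ i, Measurable (X i)) (m : ℕ) :
    P.map (fun ω i => X (m + i) ω) = P.map (fun ω i => X i ω) := by
  induction m with
  | zero => simp
  | succ m ih =>
    have hσ : Measurable fun (z : ℕ → E) i => z (i + 1) := by fun_prop
    have h1 : P.map (fun ω i => X (m + 1 + i) ω) =
        (P.map (fun ω i => X (m + i) ω)).map (fun z i => z (i + 1)) := by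
      rw [Measure.map_map hσ (by fun_prop)]
      congr 1
      ext ω i
      simp only [Function.comp]
      congr 1
      omega
    rw [h1, ih, Measure.map_map hσ (by fun_prop)]
    exact hX

theorem Stationary.lintegral_shift (hX : Stationary P X) (hXm : ∀ i, Measurable (X i)) (m : ℕ)
    {f : (ℕ → E) → ℝ≥0∞} (hf : Measurable f) :
    ∫⁻ ω, f (fun i => X (m + i) ω) ∂P = ∫⁻ ω, f (fun i => X i ω) ∂P := by
  rw [← lintegral_map hf (by fun_prop : Measurable fun ω i => X (m + i) ω),
    hX.map_shift hXm, lintegral_map hf (by fun_prop)]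

theorem Stationary.integral_shift (hX : Stationary P X) (hXm : ∀ i, Measurable (X i)) (m : ℕ)
    {f : (ℕ → E) → ℝ} (hf : Measurable f) :
    ∫ ω, f (fun i => X (m + i) ω) ∂P = ∫ ω, f (fun i => X i ω) ∂P := by
  have h1 : Measurable fun ω i => X (m + i) ω := by fun_prop
  have h2 : Measurable fun ω i => X i ω := by fun_prop
  rw [← integral_map h1.aemeasurable hf.aestronglyMeasurable,
    hX.map_shift hXm, integral_map h2.aemeasurable hf.aestronglyMeasurable]

end

/-! ### Reduction to functions of finitely many coordinates. -/

/-- Replace all coordinates from `N` on by the constant `e`. -/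
def truncSeq {E : Type*} (e : E) (N : ℕ) (z : ℕ → E) : ℕ → E := fun i => if i < N then z i else e

theorem truncSeq_eqOn {E : Type*} (e : E) (N : ℕ) (z : ℕ → E) :
    ∀ i ∈ Set.Iio N, truncSeq e N z i = z i := fun _ hi => if_pos hi

theorem dependsOn_comp_truncSeq {E F : Type*} (e : E) (N : ℕ) (f : (ℕ → E) → F) :
    DependsOn (fun z => f (truncSeq e N z)) (Set.Iio N) := by
  intro x y hxy
  dsimp only
  congr 1
  ext i
  unfold truncSeq
  split_ifs with h
  · exact hxy i h
  · rfl

theorem measurable_truncSeq {Ω E : Type*} {mΩ : MeasurableSpace Ω} [MeasurableSpace E] (e : E)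
    (N : ℕ) {Y : ℕ → Ω → E} (hY : ∀ i < N, Measurable (Y i)) :
    Measurable fun ω => truncSeq e N fun i => Y i ω := by
  refine measurable_pi_lambda _ fun i => ?_
  unfold truncSeq
  split_ifs with h
  · exact hY i h
  · exact measurable_const

/-- `DependsOn` is purely set-theoretic. Precomposing with `truncSeq` leaves `F` unchanged and
exhibits it as a measurable function of the variables `X (m + i)`, `i < N`, alone. -/
theorem measurable_sigmaOf_of_dependsOn {Ω E : Type*} [MeasurableSpace E] [Nonempty E]
    {X : ℕ → Ω → E} {F : (ℕ → E) → ℝ} (hF : Measurable F) {N : ℕ}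
    (hdep : DependsOn F (Set.Iio N)) (m : ℕ) {I : Set ℕ} (hI : ∀ i < N, m + i ∈ I) :
    Measurable[sigmaOf X I] fun ω => F fun i => X (m + i) ω := by
  have e : E := Classical.arbitrary E
  have h1 := @measurable_truncSeq _ _ (sigmaOf X I) _ e N (fun i => X (m + i))
    fun i hi => measurable_sigmaOf X (hI i hi)
  have h2 : (fun ω => F fun i => X (m + i) ω) =
      fun ω => F (truncSeq e N fun i => X (m + i) ω) := by
    ext ω
    exact (hdep (truncSeq_eqOn e N _)).symm
  rw [h2]
  exact hF.comp h1

/-- The approximants `S'` are not assumed measurable, so `S n` evaluated at a truncated sequence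
replaces them. As `S' n` does not see the truncation, two comparisons with it, each costing `ρ / 2`,
suffice. -/
theorem BlockApproximable.eventually_norm_sub_le {E : Type*} {d : ℕ}
    {S : ℕ → (ℕ → E) → EuclideanSpace ℝ (Fin d)} (h : BlockApproximable S) (e : E) {ρ : ℝ}
    (hρ : 0 < ρ) :
    ∀ᶠ n : ℕ in atTop, ∀ z, ‖S n z - S n (truncSeq e (2 * n) z)‖ ≤ n * ρ := by
  obtain ⟨S', hdep, hlim⟩ := h
  have hpos : (0 : ℝ≥0∞) < ENNReal.ofReal (ρ / 2) := by simpa using hρ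
  filter_upwards [hlim.eventually (gt_mem_nhds hpos), eventually_ge_atTop 1] with n hn hn1 z
  have hn0 : (n : ℝ≥0∞) ≠ 0 := by simpa using (by omega : n ≠ 0)
  have hz : ∀ z, ‖S n z - S' n z‖ ≤ n * (ρ / 2) := by
    intro z
    have h1 : ‖S n z - S' n z‖ₑ ≤ ENNReal.ofReal (n * (ρ / 2)) := by
      refine (le_iSup (fun z => ‖S n z - S' n z‖ₑ) z).trans ?_
      rw [ENNReal.ofReal_mul (Nat.cast_nonneg _), ENNReal.ofReal_natCast, mul_comm]
      exact (ENNReal.div_le_iff hn0 (ENNReal.natCast_ne_top n)).1 hn.le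
    rwa [← ofReal_norm, ENNReal.ofReal_le_ofReal_iff (by positivity)] at h1
  have heq : S' n (truncSeq e (2 * n) z) = S' n z := hdep n hn1 (truncSeq_eqOn e _ z)
  have h1 := hz z
  have h2 := hz (truncSeq e (2 * n) z)
  rw [heq] at h2
  calc ‖S n z - S n (truncSeq e (2 * n) z)‖
      = ‖(S n z - S' n z) - (S n (truncSeq e (2 * n) z) - S' n z)‖ := by congr 1; abel
    _ ≤ _ := norm_sub_le _ _
    _ ≤ n * ρ := by linarith

section

variable {Ω E : Type*} [MeasurableSpace Ω] [MeasurableSpace E] {P : Measure Ω}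
  [IsProbabilityMeasure P] {X : ℕ → Ω → E}

/-- Products of bounded functions of far apart blocks are nearly uncorrelated. -/
theorem integral_block_mul_le (hXm : ∀ i, Measurable (X i)) [Nonempty E]
    {F : (ℕ → E) → ℝ} {M : ℝ} (hF : Measurable F) (hF0 : ∀ z, 0 ≤ F z) (hFM : ∀ z, F z ≤ M)
    {n : ℕ} (hn : 0 < n) (hdep : DependsOn F (Set.Iio (2 * n))) {l : ℕ} (hl : 0 < l) {i j : ℕ}
    (hij : i + (l + 2) ≤ j) :
    ∫ ω, F (fun r => X (i * n + r) ω) * F (fun r => X (j * n + r) ω) ∂P ≤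
      (∫ ω, F (fun r => X (i * n + r) ω) ∂P) * (∫ ω, F (fun r => X (j * n + r) ω) ∂P) +
        M ^ 2 * alphaMixing P X l := by
  have hM : 0 ≤ M := (hF0 (fun _ => Classical.arbitrary E)).trans (hFM _)
  -- Block `i` reads the `2n` coordinates starting at `i * n`, hence overlaps the next block; this
  -- is the `2` in `l + 2`. The remaining `l` blocks leave a time gap of at least `l`.
  have hgap : i * n + 2 * n - 1 + l ≤ j * n := by
    have h1 : (i + (l + 2)) * n ≤ j * n := Nat.mul_le_mul_right n hij
    have h2 : l * 1 ≤ l * n := Nat.mul_le_mul_left l hn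
    have h3 : (i + (l + 2)) * n = i * n + (l * n + 2 * n) := by ring
    omega
  refine integral_mul_le_of_mixing (sigmaOf_le X hXm (Set.Iic (i * n + 2 * n - 1)))
    (sigmaOf_le X hXm (Set.Ici (i * n + 2 * n - 1 + l))) hM
    (fun A B hA hB => le_alphaMixing P X hl.ne' _ hA hB) ?_ (fun _ => hF0 _) (fun _ => hFM _)
    ?_ (fun _ => hF0 _) (fun _ => hFM _)
  · exact measurable_sigmaOf_of_dependsOn hF hdep _ fun r hr => by
      simp only [Set.mem_Iic]; omega
  · exact measurable_sigmaOf_of_dependsOn hF hdep _ fun r hr => by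
      simp only [Set.mem_Ici]; omega

/-- The law of large numbers behind every lower bound. Here `b` is a truncation level for `w`: `c <
a + h * b` makes the part of the mean above `b` negligible, and `b - a < κ` makes the blocks
numerous enough to average out terms as large as `exp (n b)` around a mean of rate `a`. -/
theorem ae_eventually_le_sum_of_dependsOn (hXm : ∀ i, Measurable (X i)) (hX : Stationary P X)
    (hA2 : MixingMoments P X) {w : ℕ → (ℕ → E) → ℝ} (hw : ∀ n, 1 ≤ n → Measurable (w n))
    (hdep : ∀ n, 1 ≤ n → DependsOn (w n) (Set.Iio (2 * n))) {k : ℕ → ℕ} {a b c h κ : ℝ}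
    (hh : 0 < h) (hc : c < a + h * b) (hκ : b - a < κ)
    (hk : ∀ᶠ n : ℕ in atTop, Real.exp (n * κ) ≤ k n)
    (hlow : ∀ δ : ℝ, 0 < δ → ∀ᶠ n : ℕ in atTop, ENNReal.ofReal (Real.exp (n * (a - δ))) ≤
      ∫⁻ ω, ENNReal.ofReal (Real.exp (n * w n fun i => X i ω)) ∂P)
    (hup : ∀ δ : ℝ, 0 < δ → ∀ᶠ n : ℕ in atTop,
      ∫⁻ ω, ENNReal.ofReal (Real.exp (n * ((1 + h) * w n fun i => X i ω))) ∂P ≤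
        ENNReal.ofReal (Real.exp (n * (c + δ))))
    {δ : ℝ} (hδ : 0 < δ) :
    ∀ᵐ ω ∂P, ∀ᶠ n : ℕ in atTop, ENNReal.ofReal (Real.exp (n * (a - δ))) ≤
      (k n : ℝ≥0∞)⁻¹ * ∑ j ∈ Finset.range (k n),
        ENNReal.ofReal (Real.exp (n * w n fun i => X (j * n + i) ω)) := by
  obtain ⟨ω₀⟩ := P.nonempty_of_neZero
  have : Nonempty E := ⟨X 0 ω₀⟩
  -- A common slack: the three bounds serve the final loss, the truncated tail and the variance, in
  -- this order.
  obtain ⟨s, hs, hs1, hs2, hs3⟩ : ∃ s : ℝ, 0 < s ∧ 3 * s ≤ δ ∧ 3 * s ≤ a + h * b - c ∧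
      4 * s ≤ κ - (b - a) := by
    refine ⟨min (δ / 3) (min ((a + h * b - c) / 3) ((κ - (b - a)) / 4)), ?_, ?_, ?_, ?_⟩
    · refine lt_min (by linarith) (lt_min (by linarith) (by linarith))
    · linarith [min_le_left (δ / 3) (min ((a + h * b - c) / 3) ((κ - (b - a)) / 4))]
    · linarith [(min_le_right (δ / 3) (min ((a + h * b - c) / 3) ((κ - (b - a)) / 4))).trans
        (min_le_left _ _)]
    · linarith [(min_le_right (δ / 3) (min ((a + h * b - c) / 3) ((κ - (b - a)) / 4))).trans
        (min_le_right _ _)]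
  -- The mixing error at gap `exp (n s)` is `exp (-n s (H + 1))` up to a constant; this `H` makes it
  -- beat `exp (2 n b) / p ^ 2`, with `exp (-n s)` to spare.
  obtain ⟨H, hH⟩ := exists_nat_ge ((2 * (b - a + 2 * s) + s) / s)
  rw [div_le_iff₀ hs] at hH
  obtain ⟨C, hC0, hC⟩ := hA2.exists_bound (H + 1) H.succ_pos
  -- the truncated variables
  set F : ℕ → (ℕ → E) → ℝ := fun n z => if w n z ≤ b then Real.exp (n * w n z) else 0 with hFdef
  have hFm : ∀ n, 1 ≤ n → Measurable (F n) := fun n hn =>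
    Measurable.ite (measurableSet_le (hw n hn) measurable_const)
      (Real.measurable_exp.comp ((hw n hn).const_mul _)) measurable_const
  have hF0 : ∀ n z, 0 ≤ F n z := fun n z => by
    simp only [hFdef]; split_ifs <;> positivity
  have hFM : ∀ n z, F n z ≤ Real.exp (n * b) := fun n z => by
    simp only [hFdef]
    split_ifs with hz
    · exact Real.exp_le_exp.2 (by gcongr)
    · positivity
  have hFle : ∀ n z, F n z ≤ Real.exp (n * w n z) := fun n z => by
    simp only [hFdef]; split_ifs
    · exact le_rfl
    · positivity
  have hFdep : ∀ n, 1 ≤ n → DependsOn (F n) (Set.Iio (2 * n)) := fun n hn x y hxy => by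
    simp only [hFdef, hdep n hn hxy]
  have hmX : ∀ m, Measurable fun ω i => X (m + i) ω := fun m => by fun_prop
  have hmX0 : Measurable fun ω i => X i ω := by fun_prop
  -- the mean of the truncated variables
  set p : ℕ → ℝ := fun n => ∫ ω, F n (fun i => X i ω) ∂P with hpdef
  have hp : ∀ᶠ n : ℕ in atTop, Real.exp (n * (a - 2 * s)) ≤ p n := by
    filter_upwards [hlow s hs, hup s hs, eventually_ge_atTop 1,
      eventually_ge_atTop ⌈1 / s⌉₊] with n h1 h2 hn hns
    have hns' : 1 ≤ n * s := by
      have := Nat.ceil_le.1 hns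
      rwa [div_le_iff₀ hs] at this
    have hpE : ENNReal.ofReal (p n) = ∫⁻ ω, ENNReal.ofReal (F n fun i => X i ω) ∂P := by
      refine ofReal_integral_eq_lintegral_ofReal ?_ (Eventually.of_forall fun ω => hF0 _ _)
      exact Integrable.of_bound ((hFm n hn).comp hmX0).aestronglyMeasurable (Real.exp (n * b))
        (Eventually.of_forall fun ω => by
          rw [Real.norm_of_nonneg (hF0 _ _)]; exact hFM _ _)
    -- Pointwise, `exp (n w) ≤ F + exp (-n h b) exp (n (1 + h) w)`: the second term takes over
    -- exactly where `w > b`.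
    have hsplit : ENNReal.ofReal (Real.exp (n * (a - s))) ≤
        ENNReal.ofReal (p n + Real.exp (n * (c + s - h * b))) := by
      have hp0 : 0 ≤ p n := integral_nonneg fun _ => hF0 _ _
      have hexp : ENNReal.ofReal (Real.exp (n * (c + s - h * b))) =
          ENNReal.ofReal (Real.exp (-(n * (h * b)))) *
            ENNReal.ofReal (Real.exp (n * (c + s))) := by
        rw [← ENNReal.ofReal_mul (Real.exp_pos _).le, ← Real.exp_add]
        congr 2; ring
      rw [ENNReal.ofReal_add hp0 (Real.exp_pos _).le, hpE, hexp]
      refine h1.trans ?_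
      refine le_trans ?_ (add_le_add_right (mul_le_mul_right h2 _) _)
      rw [← lintegral_const_mul' _ _ ENNReal.ofReal_ne_top,
        ← lintegral_add_left (f := fun ω => ENNReal.ofReal (F n fun i => X i ω))
          ((hFm n hn).comp hmX0).ennreal_ofReal]
      refine lintegral_mono fun ω => ?_
      rw [← ENNReal.ofReal_mul (Real.exp_pos _).le, ← ENNReal.ofReal_add (hF0 _ _) (by positivity),
        ← Real.exp_add]
      refine ENNReal.ofReal_le_ofReal ?_
      by_cases hz : (w n fun i => X i ω) ≤ b
      · simp only [hFdef, if_pos hz]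
        linarith [Real.exp_pos (-(n * (h * b)) + n * ((1 + h) * w n fun i => X i ω))]
      · simp only [hFdef, if_neg hz, zero_add]
        refine Real.exp_le_exp.2 ?_
        have : (0 : ℝ) ≤ n * (h * ((w n fun i => X i ω) - b)) := by
          have := not_le.1 hz
          have : 0 ≤ (w n fun i => X i ω) - b := by linarith
          positivity
        linarith
    rw [ENNReal.ofReal_le_ofReal_iff (add_nonneg (integral_nonneg fun _ => hF0 _ _)
      (Real.exp_pos _).le)] at hsplit
    have h3 : Real.exp (n * (c + s - h * b)) ≤ Real.exp (n * (a - 2 * s)) :=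
      Real.exp_le_exp.2 (mul_le_mul_of_nonneg_left (by linarith) (Nat.cast_nonneg n))
    have h4 : 2 * Real.exp (n * (a - 2 * s)) ≤ Real.exp (n * (a - s)) := by
      have : Real.exp (n * (a - s)) = Real.exp (n * s) * Real.exp (n * (a - 2 * s)) := by
        rw [← Real.exp_add]; congr 1; ring
      rw [this]
      gcongr
      linarith [Real.add_one_le_exp (n * s)]
    linarith
  -- Borel–Cantelli
  have hBC := ae_eventually_notMem_of_exp (P := P) (C := 32 + 4 * C) hs
    (s := fun n => {ω | ∑ j ∈ Finset.range (k n), F n (fun i => X (j * n + i) ω) ≤ k n * p n / 2})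
    (by
      filter_upwards [hp, hk, eventually_ge_atTop 1] with n hpn hkn hn
      have hp0 : 0 < p n := (Real.exp_pos _).trans_le hpn
      have hk0 : 0 < k n := by
        have : (0 : ℝ) < k n := (Real.exp_pos _).trans_le hkn
        exact_mod_cast this
      -- An exponentially long gap costs only a factor `exp (n s)` in the near-diagonal term, while
      -- power decay of the mixing coefficients becomes exponential decay of any chosen rate. The
      -- `32` below is `8 * 4`, from `l + 2 ≤ 4 exp (n s)`.
      set l := ⌈Real.exp (n * s)⌉₊ with hl
      have hl0 : 0 < l := Nat.ceil_pos.2 (Real.exp_pos _)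
      have hle : Real.exp (n * s) ≤ l := Nat.le_ceil _
      have hle' : (l : ℝ) ≤ Real.exp (n * s) + 1 := (Nat.ceil_lt_add_one (Real.exp_pos _).le).le
      have hE1 : 1 ≤ Real.exp (n * s) := Real.one_le_exp (by positivity)
      have hα : alphaMixing P X l ≤ C * Real.exp (-(n * s * (H + 1))) := by
        have h1 := hC l hl0
        have h2 : Real.exp (n * s * (H + 1)) ≤ (l : ℝ) ^ (H + 1) := by
          have : Real.exp (n * s * (H + 1)) = Real.exp (n * s) ^ (H + 1) := by
            rw [← Real.exp_nat_mul]; congr 1; push_cast; ring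
          rw [this]
          gcongr
        rw [Real.exp_neg, ← div_eq_mul_inv, le_div_iff₀ (Real.exp_pos _)]
        rcases le_or_gt 0 (alphaMixing P X l) with h0 | h0
        · exact (mul_le_mul_of_nonneg_left h2 h0).trans h1
        · exact (mul_nonpos_of_nonpos_of_nonneg h0.le (Real.exp_pos _).le).trans hC0
      refine (measure_sum_le_half (P := P) (Z := fun j ω => F n fun i => X (j * n + i) ω)
        (M := Real.exp (n * b)) (p := p n)
        (c := Real.exp (n * b) ^ 2 * (C * Real.exp (-(n * s * (H + 1)))))
        (by positivity) (fun j => (hFm n hn).comp (hmX _)) (fun j ω => hF0 _ _)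
        (fun j ω => hFM _ _) (fun j => hX.integral_shift hXm _ (hFm n hn)) (l + 2)
        (fun i j hij => ?_) hk0 hp0).trans (ENNReal.ofReal_le_ofReal ?_)
      · refine (integral_block_mul_le hXm (hFm n hn) (hF0 n) (hFM n) hn (hFdep n hn) hl0
          hij).trans ?_
        rw [hX.integral_shift hXm _ (hFm n hn), hX.integral_shift hXm _ (hFm n hn), ← sq]
        gcongr
      · have e1 : Real.exp (n * b) / (k n * p n) ≤ Real.exp (n * (-(2 * s))) := by
          rw [div_le_iff₀ (by positivity)]
          calc Real.exp (n * b) ≤ Real.exp (n * (-(2 * s))) *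
                (Real.exp (n * κ) * Real.exp (n * (a - 2 * s))) := by
                rw [← Real.exp_add, ← Real.exp_add, Real.exp_le_exp, ← mul_add, ← mul_add]
                gcongr
                linarith
            _ ≤ _ := by gcongr
        have e2 : 8 * ((l + 2 : ℕ) : ℝ) * (Real.exp (n * b) / (k n * p n)) ≤
            32 * Real.exp (-(n * s)) := by
          calc _ ≤ 8 * (4 * Real.exp (n * s)) * Real.exp (n * (-(2 * s))) := by
                gcongr
                push_cast
                linarith
            _ = 32 * (Real.exp (n * s) * Real.exp (n * (-(2 * s)))) := by ring
            _ = _ := by rw [← Real.exp_add]; congr 2; ring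
        have e3 : 4 * (Real.exp (n * b) ^ 2 * (C * Real.exp (-(n * s * (H + 1))))) / p n ^ 2 ≤
            4 * C * Real.exp (-(n * s)) := by
          rw [div_le_iff₀ (by positivity)]
          calc _ = 4 * C * (Real.exp (n * b) ^ 2 * Real.exp (-(n * s * (H + 1)))) := by ring
            _ ≤ 4 * C * (Real.exp (-(n * s)) * Real.exp (n * (a - 2 * s)) ^ 2) := by
                refine mul_le_mul_of_nonneg_left ?_ (by positivity)
                rw [← Real.exp_nat_mul, ← Real.exp_nat_mul, ← Real.exp_add, ← Real.exp_add,
                  Real.exp_le_exp]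
                push_cast
                have : (0 : ℝ) ≤ n * (H * s + s - (2 * (b - a + 2 * s) + s)) := by
                  have : 0 ≤ H * s + s - (2 * (b - a + 2 * s) + s) := by linarith
                  positivity
                linarith
            _ ≤ 4 * C * (Real.exp (-(n * s)) * p n ^ 2) := by gcongr
            _ = _ := by ring
        calc _ ≤ 32 * Real.exp (-(n * s)) + 4 * C * Real.exp (-(n * s)) := add_le_add e2 e3
          _ = _ := by ring)
  filter_upwards [hBC] with ω hω
  filter_upwards [hω, hp, hk, eventually_ge_atTop 1, eventually_ge_atTop ⌈1 / s⌉₊]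
    with n h1 hpn hkn hn hns
  have hns' : 1 ≤ n * s := by
    have := Nat.ceil_le.1 hns
    rwa [div_le_iff₀ hs] at this
  have hk0 : (0 : ℝ) < k n := (Real.exp_pos _).trans_le hkn
  rw [not_le] at h1
  have h2 : Real.exp (n * (a - δ)) ≤ p n / 2 := by
    have h4 : 2 * Real.exp (n * (a - δ)) ≤ Real.exp (n * (a - 2 * s)) := by
      calc 2 * Real.exp (n * (a - δ)) ≤ Real.exp (n * s) * Real.exp (n * (a - 3 * s)) := by
            gcongr
            linarith [Real.add_one_le_exp (n * s)]
        _ = _ := by rw [← Real.exp_add]; congr 1; ring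
    linarith
  have h3 : Real.exp (n * (a - δ)) ≤
      (k n : ℝ)⁻¹ * ∑ j ∈ Finset.range (k n), Real.exp (n * w n fun i => X (j * n + i) ω) := by
    rw [le_inv_mul_iff₀ hk0]
    calc k n * Real.exp (n * (a - δ)) ≤ k n * (p n / 2) := by gcongr
      _ = k n * p n / 2 := by ring
      _ ≤ _ := h1.le
      _ ≤ _ := Finset.sum_le_sum fun j _ => hFle _ _
  refine (ENNReal.ofReal_le_ofReal h3).trans (le_of_eq ?_)
  rw [ENNReal.ofReal_mul (by positivity), ENNReal.ofReal_inv_of_pos hk0, ENNReal.ofReal_natCast,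
    ENNReal.ofReal_sum_of_nonneg fun _ _ => (Real.exp_pos _).le]

end

/-! ### Empirical and true laws of the block averages. -/

section

variable {Ω E : Type*} [MeasurableSpace Ω] [MeasurableSpace E] {P : Measure Ω} {X : ℕ → Ω → E}
  {d : ℕ} {S : ℕ → (ℕ → E) → EuclideanSpace ℝ (Fin d)} {k : ℕ → ℕ}

theorem lintegral_avgLaw (hXm : ∀ i, Measurable (X i)) {n : ℕ} (hS : Measurable (S n))
    {f : EuclideanSpace ℝ (Fin d) → ℝ≥0∞} (hf : Measurable f) :
    ∫⁻ x, f x ∂(avgLaw P X S n) = ∫⁻ ω, f ((n : ℝ)⁻¹ • S n fun i => X i ω) ∂P := by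
  have hmX0 : Measurable fun ω i => X i ω := by fun_prop
  exact lintegral_map hf ((hS.comp hmX0).fun_const_smul (n : ℝ)⁻¹)

theorem measurable_blockAvg (hXm : ∀ i, Measurable (X i)) {n : ℕ} (hS : Measurable (S n)) (j : ℕ) :
    Measurable fun ω => blockAvg S n j fun i => X i ω := by
  have hmX0 : Measurable fun ω i => X (j * n + i) ω := by fun_prop
  exact (hS.comp hmX0).fun_const_smul (n : ℝ)⁻¹

theorem lintegral_blockAvg (hXm : ∀ i, Measurable (X i)) (hX : Stationary P X) {n : ℕ}
    (hS : Measurable (S n)) {f : EuclideanSpace ℝ (Fin d) → ℝ≥0∞} (hf : Measurable f) (j : ℕ) :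
    ∫⁻ ω, f (blockAvg S n j fun i => X i ω) ∂P = ∫⁻ x, f x ∂(avgLaw P X S n) := by
  rw [lintegral_avgLaw hXm hS hf]
  exact hX.lintegral_shift hXm (j * n) (f := fun z => f ((n : ℝ)⁻¹ • S n z))
    (hf.comp (hS.fun_const_smul _))

theorem measurable_lintegral_empLaw (hXm : ∀ i, Measurable (X i)) {n : ℕ}
    (hS : Measurable (S n)) {f : EuclideanSpace ℝ (Fin d) → ℝ≥0∞} (hf : Measurable f) :
    Measurable fun ω => ∫⁻ x, f x ∂(empLaw S k n fun i => X i ω) := by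
  simp_rw [lintegral_empLaw]
  exact (Finset.measurable_fun_sum _ fun j _ => hf.comp (measurable_blockAvg hXm hS j)).const_mul _

/-- By stationarity each block average has law `avgLaw`, whatever the dependence between blocks, so
the empirical law is unbiased. -/
theorem lintegral_lintegral_empLaw (hXm : ∀ i, Measurable (X i)) (hX : Stationary P X) {n : ℕ}
    (hS : Measurable (S n)) (hk : 1 ≤ k n) {f : EuclideanSpace ℝ (Fin d) → ℝ≥0∞}
    (hf : Measurable f) :
    ∫⁻ ω, ∫⁻ x, f x ∂(empLaw S k n fun i => X i ω) ∂P = ∫⁻ x, f x ∂(avgLaw P X S n) := by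
  simp_rw [lintegral_empLaw]
  have hm : ∀ j, Measurable fun ω => f (blockAvg S n j fun i => X i ω) := fun j =>
    hf.comp (measurable_blockAvg hXm hS j)
  rw [lintegral_const_mul _ (Finset.measurable_fun_sum _ fun j _ => hm j),
    lintegral_finsetSum _ fun j _ => hm j]
  simp_rw [lintegral_blockAvg hXm hX hS hf]
  rw [Finset.sum_const, Finset.card_range, nsmul_eq_mul, ← mul_assoc,
    ENNReal.inv_mul_cancel (by simpa using (by omega : k n ≠ 0)) (ENNReal.natCast_ne_top _),
    one_mul]

/-- Almost surely the empirical exponential rates are asymptotically at most the true ones. -/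
theorem ae_eventually_lintegral_empLaw_le (hXm : ∀ i, Measurable (X i)) (hX : Stationary P X)
    (hS : ∀ n, 1 ≤ n → Measurable (S n)) (hk : ∀ n, 1 ≤ n → 1 ≤ k n)
    {l : EuclideanSpace ℝ (Fin d)} {a : ℝ}
    (ha : Tendsto (fun n => logMGF n (avgLaw P X S n) l) atTop (𝓝 (a : EReal))) :
    ∀ᵐ ω ∂P, ∀ δ : ℝ, 0 < δ → ∀ᶠ n : ℕ in atTop,
      ∫⁻ x, ENNReal.ofReal (Real.exp (n * inner ℝ l x)) ∂(empLaw S k n fun i => X i ω) ≤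
        ENNReal.ofReal (Real.exp (n * (a + δ))) := by
  refine ae_eventually_le_of_lintegral_le (fun δ hδ => ?_) ?_
  · filter_upwards [(expRate_tendsto_iff.1 ha δ hδ).2, eventually_ge_atTop 1] with n hn hn1
    rwa [lintegral_lintegral_empLaw hXm hX (hS n hn1) (hk n hn1) (by fun_prop)]
  · filter_upwards [eventually_ge_atTop 1] with n hn1
    exact (measurable_lintegral_empLaw hXm (hS n hn1) (by fun_prop)).aemeasurable

variable [IsProbabilityMeasure P]

/-- If there are enough blocks for the tilt by `l`, then almost surely
`logMGF n (empLaw S k n X) l` has the same limit as `logMGF n (avgLaw P X S n) l`. -/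
theorem ae_tendsto_logMGF_empLaw (hXm : ∀ i, Measurable (X i)) (hX : Stationary P X)
    (hS : ∀ n, 1 ≤ n → Measurable (S n)) (hk : ∀ n, 1 ≤ n → 1 ≤ k n)
    (hA2 : MixingMoments P X) (hA3 : BlockApproximable S)
    {l : EuclideanSpace ℝ (Fin d)} {a b c h κ : ℝ} (hh : 0 < h)
    (ha : Tendsto (fun n => logMGF n (avgLaw P X S n) l) atTop (𝓝 (a : EReal)))
    (hc : Tendsto (fun n => logMGF n (avgLaw P X S n) ((1 + h) • l)) atTop (𝓝 (c : EReal)))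
    (hcb : c < a + h * b) (hκ : b - a < κ)
    (hkκ : ∀ᶠ n : ℕ in atTop, Real.exp (n * κ) ≤ k n) :
    ∀ᵐ ω ∂P, Tendsto (fun n => logMGF n (empLaw S k n fun i => X i ω) l) atTop
      (𝓝 (a : EReal)) := by
  obtain ⟨ω₀⟩ := P.nonempty_of_neZero
  set e : E := X 0 ω₀
  have hmX0 : Measurable fun ω i => X i ω := by fun_prop
  set u : ℕ → (ℕ → E) → ℝ := fun n z => inner ℝ l ((n : ℝ)⁻¹ • S n z) with hu
  -- A finite-range measurable substitute for `u`; a uniform error `ρ` between them shifts an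
  -- exponential rate by at most a multiple of `ρ`.
  set w : ℕ → (ℕ → E) → ℝ := fun n z => u n (truncSeq e (2 * n) z) with hw
  have hum : ∀ n, 1 ≤ n → Measurable (u n) := fun n hn =>
    Measurable.inner measurable_const ((hS n hn).fun_const_smul _)
  have hwm : ∀ n, 1 ≤ n → Measurable (w n) := fun n hn =>
    (hum n hn).comp (measurable_truncSeq e (2 * n) (Y := fun i (z : ℕ → E) => z i) fun i _ => by fun_prop)
  have hclose : ∀ ρ : ℝ, 0 < ρ → ∀ᶠ n : ℕ in atTop, ∀ z, |u n z - w n z| ≤ ρ := by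
    intro ρ hρ
    filter_upwards [hA3.eventually_norm_sub_le e (ρ := ρ / (‖l‖ + 1)) (by positivity),
      eventually_ge_atTop 1] with n hn hn1 z
    have hn0 : (0 : ℝ) < n := by exact_mod_cast hn1
    simp only [hw, hu]
    rw [← inner_sub_right, ← smul_sub]
    refine (abs_real_inner_le_norm _ _).trans ?_
    rw [norm_smul, norm_inv, Real.norm_natCast]
    calc ‖l‖ * ((n : ℝ)⁻¹ * ‖S n z - S n (truncSeq e (2 * n) z)‖)
        ≤ (‖l‖ + 1) * ((n : ℝ)⁻¹ * (n * (ρ / (‖l‖ + 1)))) := by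
          gcongr
          · linarith
          · exact hn z
      _ = ρ := by field_simp
  have hu_int : ∀ n, 1 ≤ n → ∀ r : ℝ,
      ∫⁻ x, ENNReal.ofReal (Real.exp (n * inner ℝ (r • l) x)) ∂(avgLaw P X S n) =
        ∫⁻ ω, ENNReal.ofReal (Real.exp (n * (r * u n fun i => X i ω))) ∂P := by
    intro n hn r
    rw [lintegral_avgLaw hXm (hS n hn) (by fun_prop)]
    simp only [hu, real_inner_smul_left]
  have hlow : ∀ δ : ℝ, 0 < δ → ∀ᶠ n : ℕ in atTop, ENNReal.ofReal (Real.exp (n * (a - δ))) ≤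
      ∫⁻ ω, ENNReal.ofReal (Real.exp (n * w n fun i => X i ω)) ∂P := by
    intro δ hδ
    filter_upwards [(expRate_tendsto_iff.1 ha (δ / 2) (by positivity)).1,
      hclose (δ / 2) (by positivity), eventually_ge_atTop 1] with n h1 h2 hn
    have h3 := hu_int n hn 1
    simp only [one_smul, one_mul] at h3
    rw [h3] at h1
    have e1 : ENNReal.ofReal (Real.exp (n * (a - δ))) =
        ENNReal.ofReal (Real.exp (n * (-(δ / 2)))) *
          ENNReal.ofReal (Real.exp (n * (a - δ / 2))) := by
      rw [← ENNReal.ofReal_mul (Real.exp_pos _).le, ← Real.exp_add]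
      congr 2; ring
    rw [e1]
    refine (mul_le_mul_right h1 _).trans ?_
    rw [← lintegral_const_mul' _ _ ENNReal.ofReal_ne_top]
    refine lintegral_mono fun ω => ?_
    rw [← ENNReal.ofReal_mul (Real.exp_pos _).le, ← Real.exp_add, ← mul_add]
    refine ENNReal.ofReal_le_ofReal (Real.exp_le_exp.2 ?_)
    gcongr
    linarith [(abs_le.1 (h2 fun i => X i ω)).2]
  have hup : ∀ δ : ℝ, 0 < δ → ∀ᶠ n : ℕ in atTop,
      ∫⁻ ω, ENNReal.ofReal (Real.exp (n * ((1 + h) * w n fun i => X i ω))) ∂P ≤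
        ENNReal.ofReal (Real.exp (n * (c + δ))) := by
    intro δ hδ
    filter_upwards [(expRate_tendsto_iff.1 hc (δ / 2) (by positivity)).2,
      hclose (δ / 2 / (1 + h)) (by positivity), eventually_ge_atTop 1] with n h1 h2 hn
    rw [hu_int n hn] at h1
    have e1 : ENNReal.ofReal (Real.exp (n * (c + δ))) =
        ENNReal.ofReal (Real.exp (n * (δ / 2))) *
          ENNReal.ofReal (Real.exp (n * (c + δ / 2))) := by
      rw [← ENNReal.ofReal_mul (Real.exp_pos _).le, ← Real.exp_add]
      congr 2; ring
    rw [e1]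
    refine le_trans ?_ (mul_le_mul_right h1 _)
    rw [← lintegral_const_mul' _ _ ENNReal.ofReal_ne_top]
    refine lintegral_mono fun ω => ?_
    rw [← ENNReal.ofReal_mul (Real.exp_pos _).le, ← Real.exp_add, ← mul_add]
    refine ENNReal.ofReal_le_ofReal (Real.exp_le_exp.2 ?_)
    gcongr
    have h3 := (abs_le.1 (h2 fun i => X i ω)).1
    have h4 : (1 + h) * (δ / 2 / (1 + h)) = δ / 2 := by field_simp
    nlinarith
  have hlower : ∀ m : ℕ, ∀ᵐ ω ∂P, ∀ᶠ n : ℕ in atTop,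
      ENNReal.ofReal (Real.exp (n * (a - 1 / (m + 1)))) ≤
      (k n : ℝ≥0∞)⁻¹ * ∑ j ∈ Finset.range (k n),
        ENNReal.ofReal (Real.exp (n * w n fun i => X (j * n + i) ω)) := fun m =>
    ae_eventually_le_sum_of_dependsOn hXm hX hA2 hwm
      (fun n _ => dependsOn_comp_truncSeq e (2 * n) (u n)) hh hcb hκ hkκ hlow hup (by positivity)
  filter_upwards [ae_all_iff.2 hlower, ae_eventually_lintegral_empLaw_le hXm hX hS hk ha]
    with ω h1 h2
  refine expRate_tendsto_iff.2 fun δ hδ => ⟨?_, h2 δ hδ⟩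
  obtain ⟨m, hm⟩ := exists_nat_one_div_lt (half_pos hδ)
  filter_upwards [h1 m, hclose (δ / 2) (by positivity)] with n h3 h4
  rw [lintegral_empLaw]
  have e1 : ENNReal.ofReal (Real.exp (n * (a - δ))) ≤
      ENNReal.ofReal (Real.exp (n * (-(δ / 2)))) *
        ENNReal.ofReal (Real.exp (n * (a - 1 / (m + 1)))) := by
    rw [← ENNReal.ofReal_mul (Real.exp_pos _).le, ← Real.exp_add, ← mul_add]
    refine ENNReal.ofReal_le_ofReal (Real.exp_le_exp.2 ?_)
    gcongr
    linarith
  refine e1.trans ((mul_le_mul_right h3 _).trans ?_)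
  rw [mul_left_comm, Finset.mul_sum]
  gcongr with j _
  rw [← ENNReal.ofReal_mul (Real.exp_pos _).le, ← Real.exp_add, ← mul_add]
  refine ENNReal.ofReal_le_ofReal (Real.exp_le_exp.2 ?_)
  gcongr
  have := (abs_le.1 (h4 fun i => X (j * n + i) ω)).1
  change _ ≤ u n fun i => X (j * n + i) ω
  linarith

end

/-! ### Convexity and duality -/

theorem hasDerivAt_comp_line {d : ℕ} {f : EuclideanSpace ℝ (Fin d) → ℝ}
    {x₀ l₀ : EuclideanSpace ℝ (Fin d)} (hf : HasGradientAt f x₀ l₀)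
    (v : EuclideanSpace ℝ (Fin d)) :
    HasDerivAt (fun s : ℝ => f (l₀ + s • v)) (inner ℝ v x₀) 0 := by
  have h1 : HasDerivAt (fun s : ℝ => l₀ + s • v) v 0 := by
    simpa using ((hasDerivAt_id (0 : ℝ)).smul_const v).const_add l₀
  have h2 : HasFDerivAt f ((InnerProductSpace.toDual ℝ _) x₀) (l₀ + (0 : ℝ) • v) := by
    simpa using hf.hasFDerivAt
  have h3 := h2.comp_hasDerivAt (0 : ℝ) h1
  rw [real_inner_comm]
  exact h3

/-- The form in which differentiability enters the Chernoff bounds: a small step along `v` costs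
hardly more than its linear term. -/
theorem eventually_line_le {d : ℕ} {f : EuclideanSpace ℝ (Fin d) → ℝ}
    {x₀ l₀ : EuclideanSpace ℝ (Fin d)} (hf : HasGradientAt f x₀ l₀)
    (v : EuclideanSpace ℝ (Fin d)) {ρ : ℝ} (hρ : 0 < ρ) :
    ∀ᶠ s : ℝ in 𝓝[>] 0, f (l₀ + s • v) ≤ f l₀ + s * (inner ℝ v x₀ + ρ) := by
  have h := (hasDerivAt_comp_line hf v).tendsto_slope_zero_right
  have h2 := h.eventually (gt_mem_nhds (lt_add_of_pos_right (inner ℝ v x₀ : ℝ) hρ))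
  filter_upwards [h2, self_mem_nhdsWithin] with s hs (hs0 : 0 < s)
  simp only [zero_add, zero_smul, add_zero, smul_eq_mul] at hs
  rw [inv_mul_lt_iff₀ hs0] at hs
  linarith

theorem tendsto_line {d : ℕ} (l₀ v : EuclideanSpace ℝ (Fin d)) :
    Tendsto (fun s : ℝ => l₀ + s • v) (𝓝[>] 0) (𝓝 l₀) := by
  have : Continuous fun s : ℝ => l₀ + s • v := by fun_prop
  simpa using this.continuousAt.tendsto.mono_left (nhdsWithin_le_nhds (a := (0 : ℝ)))

/-- Limits of `logMGF` inherit convexity. -/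
theorem limit_logMGF_convex_le {d : ℕ} {μ : ℕ → Measure (EuclideanSpace ℝ (Fin d))}
    {l₁ l₂ : EuclideanSpace ℝ (Fin d)} {c₁ c₂ c a b : ℝ} (ha : 0 ≤ a) (hb : 0 ≤ b)
    (hab : a + b = 1)
    (h₁ : ∀ δ : ℝ, 0 < δ → ∀ᶠ n in atTop, logMGF n (μ n) l₁ ≤ ((c₁ + δ : ℝ) : EReal))
    (h₂ : ∀ δ : ℝ, 0 < δ → ∀ᶠ n in atTop, logMGF n (μ n) l₂ ≤ ((c₂ + δ : ℝ) : EReal))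
    (h : Tendsto (fun n => logMGF n (μ n) (a • l₁ + b • l₂)) atTop (𝓝 (c : EReal))) :
    c ≤ a * c₁ + b * c₂ := by
  refine le_of_forall_pos_le_add fun δ hδ => ?_
  rw [← EReal.coe_le_coe_iff]
  refine le_of_tendsto h ?_
  filter_upwards [h₁ δ hδ, h₂ δ hδ, eventually_gt_atTop 0] with n hn₁ hn₂ hn
  refine (logMGF_convex_le hn (μ n) ha hb hab hn₁ hn₂).trans (le_of_eq ?_)
  congr 1
  linear_combination δ * hab

/-- The tangent hyperplane at a point of differentiability lies below the limiting `logMGF`. -/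
theorem tangent_le_limLogMGF {d : ℕ} {μ : ℕ → Measure (EuclideanSpace ℝ (Fin d))}
    {f : EuclideanSpace ℝ (Fin d) → ℝ} {x₀ l₀ : EuclideanSpace ℝ (Fin d)}
    (hlim : ∀ᶠ l in 𝓝 l₀, Tendsto (fun n => logMGF n (μ n) l) atTop (𝓝 (f l : EReal)))
    (hf : HasGradientAt f x₀ l₀) (l : EuclideanSpace ℝ (Fin d)) :
    ((f l₀ + inner ℝ (l - l₀) x₀ : ℝ) : EReal) ≤ limLogMGF μ l := by
  by_contra! hlt
  obtain ⟨c, hc1, hc2⟩ := EReal.lt_iff_exists_real_btwn.1 hlt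
  rw [EReal.coe_lt_coe_iff] at hc2
  have hev := eventually_lt_of_limsup_lt hc1
  have hslope := (hasDerivAt_comp_line hf (l - l₀)).tendsto_slope_zero_right
  -- The limit need not exist at `l`, but an upper bound `c` there suffices: convexity on the
  -- segment bounds all difference quotients at `l₀` by `c - f l₀`, hence also the derivative,
  -- contradicting the choice of `c`.
  have hle : inner ℝ (l - l₀) x₀ ≤ c - f l₀ := by
    refine le_of_tendsto hslope ?_
    filter_upwards [(tendsto_line l₀ (l - l₀)).eventually hlim, self_mem_nhdsWithin,
      nhdsWithin_le_nhds (Iic_mem_nhds (zero_lt_one (α := ℝ)))] with s hs (hs0 : 0 < s)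
      (hs1 : s ≤ 1)
    have hcomb : l₀ + s • (l - l₀) = (1 - s) • l₀ + s • l := by module
    rw [hcomb] at hs
    have := limit_logMGF_convex_le (c₁ := f l₀) (c₂ := c) (by linarith) hs0.le (by ring)
      (fun δ hδ => (ereal_tendsto_coe_iff.1 hlim.self_of_nhds δ hδ).2)
      (fun δ hδ => by
        filter_upwards [hev] with n hn
        exact hn.le.trans (EReal.coe_le_coe_iff.2 (by linarith))) hs
    simp only [zero_add, zero_smul, add_zero, smul_eq_mul]
    rw [hcomb, inv_mul_le_iff₀ hs0]
    linarith
  linarith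

/-- A global supporting hyperplane of slope `x₀` at `l₀` says precisely that the supremum is
attained at `l₀`. -/
theorem legendre_eq {d : ℕ} {L : EuclideanSpace ℝ (Fin d) → EReal}
    {x₀ l₀ : EuclideanSpace ℝ (Fin d)} {a : ℝ} (ha : L l₀ = a)
    (h : ∀ l, ((a + inner ℝ (l - l₀) x₀ : ℝ) : EReal) ≤ L l) :
    legendre L x₀ = ((inner ℝ l₀ x₀ - a : ℝ) : EReal) := by
  refine le_antisymm (iSup_le fun l => ?_) ?_
  · refine (EReal.sub_le_sub le_rfl (h l)).trans (le_of_eq ?_)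
    rw [← EReal.coe_sub, inner_sub_left]
    congr 1
    ring
  · refine le_trans (le_of_eq ?_) (le_iSup _ l₀)
    rw [ha, EReal.coe_sub]

theorem convexOn_of_tendsto_logMGF {d : ℕ} {μ : ℕ → Measure (EuclideanSpace ℝ (Fin d))}
    {f : EuclideanSpace ℝ (Fin d) → ℝ} {D : Set (EuclideanSpace ℝ (Fin d))} (hD : Convex ℝ D)
    (hlim : ∀ l ∈ D, Tendsto (fun n => logMGF n (μ n) l) atTop (𝓝 (f l : EReal))) :
    ConvexOn ℝ D f := by
  refine ⟨hD, fun x hx y hy a b ha hb hab => ?_⟩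
  exact limit_logMGF_convex_le ha hb hab
    (fun δ hδ => (ereal_tendsto_coe_iff.1 (hlim x hx) δ hδ).2)
    (fun δ hδ => (ereal_tendsto_coe_iff.1 (hlim y hy) δ hδ).2) (hlim _ (hD hx hy ha hb hab))

section

variable {E : Type*} {d : ℕ} (S : ℕ → (ℕ → E) → EuclideanSpace ℝ (Fin d)) {k : ℕ → ℕ} {n : ℕ}

/-- A nonempty finite average of exponentials is positive and finite, so `toReal` loses nothing. -/
theorem coe_toReal_logMGF_empLaw (hk : 0 < k n) (x : ℕ → E) (l : EuclideanSpace ℝ (Fin d)) :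
    ((logMGF n (empLaw S k n x) l).toReal : EReal) = logMGF n (empLaw S k n x) l := by
  have hk' : (0 : ℝ) < k n := Nat.cast_pos.2 hk
  have hsum : 0 < ∑ j ∈ Finset.range (k n), Real.exp (n * inner ℝ l (blockAvg S n j x)) :=
    Finset.sum_pos (fun _ _ => Real.exp_pos _) (by simpa using hk.ne')
  rw [logMGF_eq_expRate, lintegral_empLaw, ← ENNReal.ofReal_sum_of_nonneg
    fun _ _ => (Real.exp_pos _).le, ← ENNReal.ofReal_natCast, ← ENNReal.ofReal_inv_of_pos hk',
    ← ENNReal.ofReal_mul (by positivity), expRate_ofReal (by positivity), EReal.toReal_coe]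

theorem convexOn_logMGF_empLaw (hn : 0 < n) (hk : 0 < k n) (x : ℕ → E) :
    ConvexOn ℝ Set.univ fun l => (logMGF n (empLaw S k n x) l).toReal := by
  refine ⟨convex_univ, fun l₁ _ l₂ _ a b ha hb hab => ?_⟩
  have := logMGF_convex_le hn (empLaw S k n x) ha hb hab
    (coe_toReal_logMGF_empLaw S hk x l₁).ge (coe_toReal_logMGF_empLaw S hk x l₂).ge
  rw [← coe_toReal_logMGF_empLaw S hk, EReal.coe_le_coe_iff] at this
  exact this

end

/-! ### From pointwise to uniform convergence of convex functions. -/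

/-- Pointwise convergence of convex functions on a rich enough set is uniform on a ball. -/
theorem tendstoUniformlyOn_closedBall_of_convexOn {V : Type*} [NormedAddCommGroup V]
    [NormedSpace ℝ V] [ProperSpace V] {g : ℕ → V → ℝ} {f : V → ℝ} {x₀ : V} {r : ℝ} (hr : 0 < r)
    {Q T : Set V} (hg : ∀ᶠ n in atTop, ConvexOn ℝ Set.univ (g n))
    (hf : ContinuousOn f (Metric.ball x₀ (2 * r))) (hT : T.Finite) (hTQ : T ⊆ Q)
    (hball : Metric.ball x₀ (3 * r) ⊆ convexHull ℝ T) (hx₀ : x₀ ∈ Q)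
    (hQ : Metric.ball x₀ (2 * r) ⊆ closure Q)
    (hlim : ∀ q ∈ Q, Tendsto (fun n => g n q) atTop (𝓝 (f q))) :
    TendstoUniformlyOn g f atTop (Metric.closedBall x₀ r) := by
  -- a uniform bound
  obtain ⟨C, hC0, hCx, hCT⟩ : ∃ C : ℝ, 0 < C ∧ -C < f x₀ ∧ ∀ t ∈ T, f t < C := by
    obtain ⟨B, hB⟩ := (hT.image f).bddAbove
    refine ⟨max (B + 1) (|f x₀| + 1), lt_max_of_lt_right (by positivity), ?_, fun t ht => ?_⟩
    · have := neg_abs_le (f x₀)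
      linarith [le_max_right (B + 1) (|f x₀| + 1)]
    · have := hB (Set.mem_image_of_mem f ht)
      linarith [le_max_left (B + 1) (|f x₀| + 1)]
  -- On the hull of `T` a convex function is at most its maximum over `T`. Reflecting `a` through
  -- `x₀` turns this into the lower bound `2 * (-C) - C`.
  have hbound : ∀ᶠ n in atTop, ∀ a, dist a x₀ < 3 * r → |g n a| ≤ 3 * C := by
    filter_upwards [hg, (hT.eventually_all (l := atTop)
      (p := fun t n => g n t < C)).2 fun t ht => (hlim t (hTQ ht)).eventually (gt_mem_nhds (hCT t ht)),
      (hlim x₀ hx₀).eventually (lt_mem_nhds hCx)] with n hgn hnT hnx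
    have hup : ∀ a, dist a x₀ < 3 * r → g n a ≤ C := by
      intro a ha
      obtain ⟨t, ht, hat⟩ := hgn.exists_ge_of_mem_convexHull (Set.subset_univ T) (hball ha)
      exact hat.trans (hnT t ht).le
    intro a ha
    have h1 := hup a ha
    have h2 := hup ((2 : ℝ) • x₀ - a) (by
      rw [dist_eq_norm] at ha ⊢
      have : (2 : ℝ) • x₀ - a - x₀ = -(a - x₀) := by module
      rwa [this, norm_neg])
    have h3 := hgn.2 (Set.mem_univ a) (Set.mem_univ ((2 : ℝ) • x₀ - a))
      (by norm_num : (0 : ℝ) ≤ 1 / 2) (by norm_num : (0 : ℝ) ≤ 1 / 2) (by norm_num)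
    have h4 : (1 / 2 : ℝ) • a + (1 / 2 : ℝ) • ((2 : ℝ) • x₀ - a) = x₀ := by module
    rw [h4, smul_eq_mul, smul_eq_mul] at h3
    rw [abs_le]
    constructor <;> linarith
  set K := (2 * (3 * C) / r).toNNReal with hK
  -- Bounded convex functions are Lipschitz on a smaller ball, with a constant independent of `n`;
  -- equicontinuity then transfers convergence from `Q` to its closure.
  have hlip : ∀ᶠ n in atTop, LipschitzOnWith K (g n) (Metric.ball x₀ (2 * r)) := by
    filter_upwards [hg, hbound] with n hgn hbn
    have := (hgn.subset (Set.subset_univ _) (convex_ball x₀ (3 * r))).lipschitzOnWith_of_abs_le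
      hr hbn
    convert this using 2
    ring
  rw [← tendstoLocallyUniformlyOn_iff_tendstoUniformlyOn_of_compact (isCompact_closedBall x₀ r)]
  rw [Metric.tendstoLocallyUniformlyOn_iff]
  intro ε hε x hx
  have hx2 : x ∈ Metric.ball x₀ (2 * r) := Metric.closedBall_subset_ball (by linarith) hx
  have hfx : ContinuousAt f x := hf.continuousAt (Metric.isOpen_ball.mem_nhds hx2)
  obtain ⟨η₁, hη₁, hfη⟩ := Metric.continuousAt_iff.1 hfx (ε / 6) (by positivity)
  obtain ⟨η, hη, hηle, hηr, hηK⟩ : ∃ η : ℝ, 0 < η ∧ η ≤ η₁ ∧ η ≤ r ∧ K * (2 * η) ≤ ε / 3 := by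
    refine ⟨min η₁ (min r (ε / (6 * (K + 1)))), lt_min hη₁ (lt_min hr (by positivity)),
      min_le_left _ _, (min_le_right _ _).trans (min_le_left _ _), ?_⟩
    have h1 : min η₁ (min r (ε / (6 * (K + 1)))) ≤ ε / (6 * (K + 1)) :=
      (min_le_right _ _).trans (min_le_right _ _)
    calc K * (2 * min η₁ (min r (ε / (6 * (K + 1))))) ≤ (K + 1) * (2 * (ε / (6 * (K + 1)))) := by
          gcongr
          linarith
      _ = ε / 3 := by field_simp; norm_num
  obtain ⟨q, hqQ, hqx⟩ := Metric.mem_closure_iff.1 (hQ hx2) η hη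
  have hsub : Metric.ball x η ⊆ Metric.ball x₀ (2 * r) := by
    intro y hy
    rw [Metric.mem_ball] at hy ⊢
    have := Metric.mem_closedBall.1 hx
    linarith [dist_triangle y x x₀]
  refine ⟨Metric.ball x η, nhdsWithin_le_nhds (Metric.ball_mem_nhds x hη), ?_⟩
  filter_upwards [hlip, (hlim q hqQ).eventually (Metric.ball_mem_nhds (f q)
    (by positivity : 0 < ε / 3))] with n hn hnq y hy
  have hqb : q ∈ Metric.ball x η := by rwa [Metric.mem_ball, dist_comm]
  have h1 := hn.dist_le_mul q (hsub hqb) y (hsub hy)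
  have h2 : dist q y ≤ 2 * η := by
    have := Metric.mem_ball.1 hy
    have := Metric.mem_ball.1 hqb
    linarith [dist_triangle_right q y x]
  have h3 : dist (g n q) (g n y) ≤ ε / 3 := h1.trans ((mul_le_mul_of_nonneg_left h2 K.2).trans hηK)
  have h4 := hfη ((Metric.mem_ball.1 hy).trans_le hηle)
  have h5 := hfη ((Metric.mem_ball.1 hqb).trans_le hηle)
  have h6 := Metric.mem_ball.1 hnq
  have h7 := dist_triangle4 (f y) (f q) (g n q) (g n y)
  have h8 := dist_triangle_right (f y) (f q) (f x)
  rw [dist_comm] at h6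
  linarith

/-! ### The local Gärtner–Ellis argument -/

theorem abs_inner_sub_le_of_mem_closedBall {V : Type*} [NormedAddCommGroup V]
    [InnerProductSpace ℝ V] (l : V) {x x₀ : V} {ε : ℝ} (hx : x ∈ Metric.closedBall x₀ ε) :
    |inner ℝ l x - inner ℝ l x₀| ≤ ε * ‖l‖ := by
  rw [← inner_sub_right]
  refine (abs_real_inner_le_norm _ _).trans ?_
  rw [mul_comm]
  gcongr
  exact mem_closedBall_iff_norm.1 hx

/-- The Chernoff bound, used for the true, empirical and tilted measures alike. -/
theorem measure_halfspace_le {d : ℕ} (ν : Measure (EuclideanSpace ℝ (Fin d))) (n : ℕ)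
    (l : EuclideanSpace ℝ (Fin d)) {s : Set (EuclideanSpace ℝ (Fin d))} {b : ℝ}
    (hs : ∀ x ∈ s, b ≤ inner ℝ l x) :
    ν s ≤ ENNReal.ofReal (Real.exp (-(n * b))) *
      ∫⁻ x, ENNReal.ofReal (Real.exp (n * inner ℝ l x)) ∂ν := by
  rw [← lintegral_const_mul' _ _ ENNReal.ofReal_ne_top]
  refine le_trans ?_ (meas_ge_le_lintegral_div (μ := ν) (ε := 1)
    (f := fun x => ENNReal.ofReal (Real.exp (-(n * b))) *
      ENNReal.ofReal (Real.exp (n * inner ℝ l x))) (by fun_prop) one_ne_zero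
      ENNReal.one_ne_top |>.trans (by simp))
  refine measure_mono fun x hx => ?_
  change 1 ≤ ENNReal.ofReal (Real.exp (-(n * b))) * ENNReal.ofReal (Real.exp (n * inner ℝ l x))
  rw [← ENNReal.ofReal_mul (Real.exp_pos _).le, ← Real.exp_add, ENNReal.one_le_ofReal,
    Real.one_le_exp_iff]
  have : (n : ℝ) * b ≤ n * inner ℝ l x := by gcongr; exact hs x hx
  linarith

theorem eventually_measure_closedBall_le {d : ℕ} {ν : ℕ → Measure (EuclideanSpace ℝ (Fin d))}
    {l₀ x₀ : EuclideanSpace ℝ (Fin d)} {a : ℝ}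
    (ha : Tendsto (fun n => logMGF n (ν n) l₀) atTop (𝓝 (a : EReal))) (ε : ℝ) {δ : ℝ}
    (hδ : 0 < δ) :
    ∀ᶠ n : ℕ in atTop, ν n (Metric.closedBall x₀ ε) ≤
      ENNReal.ofReal (Real.exp (n * (-(inner ℝ l₀ x₀ - a) + ε * ‖l₀‖ + δ))) := by
  filter_upwards [(expRate_tendsto_iff.1 ha δ hδ).2] with n hn
  refine (measure_halfspace_le (ν n) n l₀ (b := inner ℝ l₀ x₀ - ε * ‖l₀‖) fun x hx => ?_).trans
    ((mul_le_mul_right hn _).trans (le_of_eq ?_))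
  · linarith [(abs_le.1 (abs_inner_sub_le_of_mem_closedBall l₀ hx)).1]
  · rw [← ENNReal.ofReal_mul (Real.exp_pos _).le, ← Real.exp_add]
    congr 2
    ring

/-- The directions are plus and minus the coordinate vectors. It lets finitely many half-spaces
cover the complement of a ball, so that Chernoff bounds apply there; `d + 1` also covers `d = 0`. -/
theorem exists_finset_inner_le_norm_le (d : ℕ) {ε : ℝ} (hε : 0 < ε) :
    ∃ (W : Finset (EuclideanSpace ℝ (Fin d))) (η : ℝ), 0 < η ∧
      ∀ x, (∀ v ∈ W, inner ℝ v x ≤ η) → ‖x‖ ≤ ε := by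
  classical
  refine ⟨Finset.univ.image (fun i => EuclideanSpace.single i (1 : ℝ)) ∪
    Finset.univ.image (fun i => -EuclideanSpace.single i (1 : ℝ)), ε / (d + 1), by positivity,
    fun x hx => ?_⟩
  have hcoord : ∀ i, ‖x i‖ ≤ ε / (d + 1) := by
    intro i
    have h1 := hx (EuclideanSpace.single i 1) (by simp)
    have h2 := hx (-EuclideanSpace.single i 1) (by simp)
    simp only [inner_neg_left, EuclideanSpace.inner_single_left, map_one, one_mul] at h1 h2
    rw [Real.norm_eq_abs, abs_le]
    constructor <;> linarith
  have h1 : ‖x‖ ≤ ∑ i, ‖x i‖ := by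
    conv_lhs => rw [← (EuclideanSpace.basisFun (Fin d) ℝ).sum_repr x]
    refine (norm_sum_le _ _).trans (Finset.sum_le_sum fun i _ => ?_)
    rw [norm_smul]
    simp
  calc ‖x‖ ≤ ∑ i, ‖x i‖ := h1
    _ ≤ ∑ _i : Fin d, ε / (d + 1) := Finset.sum_le_sum fun i _ => hcoord i
    _ = d * (ε / (d + 1)) := by simp
    _ ≤ ε := by
        rw [mul_div_assoc', div_le_iff₀ (by positivity)]
        nlinarith

/-- Tilting by `l₀` gives total mass of rate `f l₀`. Differentiability makes the tilted mass of
every half-space missing `x₀` exponentially smaller, so the ball carries almost everything; undoing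
the tilt on the ball costs `⟨l₀, x₀⟩ + ε ‖l₀‖`. -/
theorem eventually_le_measure_closedBall {d : ℕ} {ν : ℕ → Measure (EuclideanSpace ℝ (Fin d))}
    {f : EuclideanSpace ℝ (Fin d) → ℝ} {l₀ x₀ : EuclideanSpace ℝ (Fin d)}
    (hlim : ∀ᶠ l in 𝓝 l₀, Tendsto (fun n => logMGF n (ν n) l) atTop (𝓝 (f l : EReal)))
    (hf : HasGradientAt f x₀ l₀) {ε δ : ℝ} (hε : 0 < ε) (hδ : 0 < δ) :
    ∀ᶠ n : ℕ in atTop, ENNReal.ofReal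
      (Real.exp (n * (-(inner ℝ l₀ x₀ - f l₀) - ε * ‖l₀‖ - δ))) ≤
        ν n (Metric.closedBall x₀ ε) := by
  obtain ⟨W, η, hη, hW⟩ := exists_finset_inner_le_norm_le d hε
  set τ : ℕ → Measure (EuclideanSpace ℝ (Fin d)) := fun n =>
    (ν n).withDensity fun x => ENNReal.ofReal (Real.exp (n * inner ℝ l₀ x)) with hτ
  set A : EuclideanSpace ℝ (Fin d) → Set (EuclideanSpace ℝ (Fin d)) :=
    fun v => {x | η < inner ℝ v (x - x₀)} with hA
  have htail : ∀ v, ∃ γ : ℝ, 0 < γ ∧ ∀ᶠ n : ℕ in atTop,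
      τ n (A v) ≤ ENNReal.ofReal (Real.exp (n * (f l₀ - γ))) := by
    intro v
    obtain ⟨h, hlimh, hle, hh⟩ := (((tendsto_line l₀ v).eventually hlim).and
      ((eventually_line_le hf v (half_pos hη)).and self_mem_nhdsWithin)).exists
    replace hh : 0 < h := hh
    -- The Chernoff exponent `f (l₀ + h v) - h (⟨v, x₀⟩ + η)` is at most `f l₀ - h η / 2`; half of
    -- this gain pays for the convergence error.
    refine ⟨h * η / 4, by positivity, ?_⟩
    filter_upwards [(expRate_tendsto_iff.1 hlimh (h * η / 4) (by positivity)).2] with n hn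
    have hint : ∫⁻ x, ENNReal.ofReal (Real.exp (n * inner ℝ (h • v) x)) ∂(τ n) =
        ∫⁻ x, ENNReal.ofReal (Real.exp (n * inner ℝ (l₀ + h • v) x)) ∂(ν n) := by
      rw [hτ, lintegral_withDensity_eq_lintegral_mul _ (by fun_prop) (by fun_prop)]
      refine lintegral_congr fun x => ?_
      rw [Pi.mul_apply, ← ENNReal.ofReal_mul (Real.exp_pos _).le, ← Real.exp_add, ← mul_add,
        inner_add_left]
    refine (measure_halfspace_le (τ n) n (h • v) (b := h * (inner ℝ v x₀ + η))
      fun x hx => ?_).trans ?_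
    · rw [real_inner_smul_left]
      have : η < inner ℝ v (x - x₀) := hx
      rw [inner_sub_right] at this
      gcongr
      linarith
    · rw [hint]
      refine (mul_le_mul_right hn _).trans ?_
      rw [← ENNReal.ofReal_mul (Real.exp_pos _).le, ← Real.exp_add]
      refine ENNReal.ofReal_le_ofReal (Real.exp_le_exp.2 ?_)
      have : (n : ℝ) * (f (l₀ + h • v)) ≤ n * (f l₀ + h * (inner ℝ v x₀ + η / 2)) := by gcongr
      nlinarith
  obtain ⟨γ, hγ, htails⟩ : ∃ γ : ℝ, 0 < γ ∧ ∀ᶠ n : ℕ in atTop, ∀ v ∈ W,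
      τ n (A v) ≤ ENNReal.ofReal (Real.exp (n * (f l₀ - γ))) := by
    choose γ hγ hev using htail
    obtain ⟨γ₀, hγ₀, hle⟩ : ∃ γ₀ : ℝ, 0 < γ₀ ∧ ∀ v ∈ W, γ₀ ≤ γ v := by
      classical
      clear hW
      induction W using Finset.induction_on with
      | empty => exact ⟨1, one_pos, by simp⟩
      | insert w W _ ih =>
        obtain ⟨g, hg, hgle⟩ := ih
        refine ⟨min g (γ w), lt_min hg (hγ w), fun v hv => ?_⟩
        rcases Finset.mem_insert.1 hv with rfl | hv
        · exact min_le_right _ _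
        · exact (min_le_left _ _).trans (hgle v hv)
    refine ⟨γ₀, hγ₀, ?_⟩
    rw [Finset.eventually_all]
    intro v hv
    filter_upwards [hev v] with n hn
    refine hn.trans (ENNReal.ofReal_le_ofReal (Real.exp_le_exp.2 ?_))
    gcongr
    exact hle v hv
  set s : ℝ := min δ γ / 4 with hs
  have hs0 : 0 < s := by positivity
  have hsδ : 4 * s ≤ δ := by rw [hs]; linarith [min_le_left δ γ]
  have hsγ : 4 * s ≤ γ := by rw [hs]; linarith [min_le_right δ γ]
  filter_upwards [htails, (expRate_tendsto_iff.1 hlim.self_of_nhds s hs0).1,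
    eventually_ge_atTop ⌈(W.card + 1 : ℝ) / s⌉₊] with n h1 h2 hn
  have hns : W.card + 1 ≤ n * s := by
    have := Nat.ceil_le.1 hn
    rwa [div_le_iff₀ hs0] at this
  have hball : τ n (Metric.closedBall x₀ ε) ≤
      ENNReal.ofReal (Real.exp (n * (inner ℝ l₀ x₀ + ε * ‖l₀‖))) *
        ν n (Metric.closedBall x₀ ε) := by
    rw [hτ, withDensity_apply _ Metric.isClosed_closedBall.measurableSet, ← setLIntegral_const]
    refine setLIntegral_mono' Metric.isClosed_closedBall.measurableSet fun x hx => ?_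
    refine ENNReal.ofReal_le_ofReal (Real.exp_le_exp.2 ?_)
    gcongr
    linarith [(abs_le.1 (abs_inner_sub_le_of_mem_closedBall l₀ hx)).2]
  have hcover : (Set.univ : Set (EuclideanSpace ℝ (Fin d))) ⊆
      Metric.closedBall x₀ ε ∪ ⋃ v ∈ W, A v := by
    intro x _
    by_contra hx
    simp only [Set.mem_union, Set.mem_iUnion, not_or, not_exists] at hx
    exact hx.1 (mem_closedBall_iff_norm.2 (hW _ fun v hv => not_lt.1 (hx.2 v hv)))
  have htotal : ∫⁻ x, ENNReal.ofReal (Real.exp (n * inner ℝ l₀ x)) ∂(ν n) ≤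
      τ n (Metric.closedBall x₀ ε) +
        ENNReal.ofReal (W.card * Real.exp (n * (f l₀ - γ))) := by
    rw [← setLIntegral_univ, ← withDensity_apply _ MeasurableSet.univ]
    refine (measure_mono hcover).trans ((measure_union_le _ _).trans ?_)
    gcongr
    refine (measure_biUnion_finset_le W A).trans ((Finset.sum_le_sum h1).trans ?_)
    rw [Finset.sum_const, nsmul_eq_mul, ENNReal.ofReal_mul (Nat.cast_nonneg _),
      ENNReal.ofReal_natCast]
  -- Otherwise the total tilted mass would be below `W.card + 1` terms of rate `f l₀ - 2 s`, and
  -- `exp (n s)` absorbs that number.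
  have hmain : ENNReal.ofReal (Real.exp (n * (f l₀ - 2 * s))) ≤
      τ n (Metric.closedBall x₀ ε) := by
    by_contra! hlt
    have h3 := (h2.trans htotal).trans_lt (ENNReal.add_lt_add_right ENNReal.ofReal_ne_top hlt)
    rw [← ENNReal.ofReal_add (by positivity) (by positivity),
      ENNReal.ofReal_lt_ofReal_iff (by positivity)] at h3
    have h4 : Real.exp (n * (f l₀ - γ)) ≤ Real.exp (n * (f l₀ - 2 * s)) :=
      Real.exp_le_exp.2 (by gcongr; linarith)
    have h5 : (W.card + 1) * Real.exp (n * (f l₀ - 2 * s)) ≤ Real.exp (n * (f l₀ - s)) := by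
      have : Real.exp (n * (f l₀ - s)) = Real.exp (n * s) * Real.exp (n * (f l₀ - 2 * s)) := by
        rw [← Real.exp_add]; congr 1; ring
      rw [this]
      gcongr
      linarith [Real.add_one_le_exp (n * s)]
    have h6 : (W.card : ℝ) * Real.exp (n * (f l₀ - γ)) ≤
        W.card * Real.exp (n * (f l₀ - 2 * s)) := by gcongr
    linarith
  have h7 := hmain.trans hball
  calc ENNReal.ofReal (Real.exp (n * (-(inner ℝ l₀ x₀ - f l₀) - ε * ‖l₀‖ - δ)))
      ≤ ENNReal.ofReal (Real.exp (-(n * (inner ℝ l₀ x₀ + ε * ‖l₀‖)))) *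
        ENNReal.ofReal (Real.exp (n * (f l₀ - 2 * s))) := by
        rw [← ENNReal.ofReal_mul (Real.exp_pos _).le, ← Real.exp_add]
        refine ENNReal.ofReal_le_ofReal (Real.exp_le_exp.2 ?_)
        have : (n : ℝ) * (2 * s) ≤ n * δ := by gcongr; linarith
        linarith
    _ ≤ _ := mul_le_mul_right h7 _
    _ = ν n (Metric.closedBall x₀ ε) := by
        rw [← mul_assoc, ← ENNReal.ofReal_mul (Real.exp_pos _).le, ← Real.exp_add]
        simp

/-! ### The main theorem -/

theorem eventually_exp_le_of_lt_log_div {k : ℕ → ℕ} {κ : ℝ} (hk : ∀ n, 1 ≤ n → 1 ≤ k n)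
    (h : ∀ᶠ n : ℕ in atTop, (κ : EReal) < ((Real.log (k n) / n : ℝ) : EReal)) :
    ∀ᶠ n : ℕ in atTop, Real.exp (n * κ) ≤ k n := by
  filter_upwards [h, eventually_ge_atTop 1] with n hn hn1
  have hk0 : (0 : ℝ) < k n := Nat.cast_pos.2 (hk n hn1)
  rw [EReal.coe_lt_coe_iff, lt_div_iff₀ (by exact_mod_cast hn1)] at hn
  rw [← Real.le_log_iff_exp_le hk0]
  linarith

theorem eventually_le_exp_of_log_div_lt {k : ℕ → ℕ} {κ : ℝ} (hk : ∀ n, 1 ≤ n → 1 ≤ k n)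
    (h : ∀ᶠ n : ℕ in atTop, ((Real.log (k n) / n : ℝ) : EReal) < (κ : EReal)) :
    ∀ᶠ n : ℕ in atTop, (k n : ℝ) ≤ Real.exp (n * κ) := by
  filter_upwards [h, eventually_ge_atTop 1] with n hn hn1
  have hk0 : (0 : ℝ) < k n := Nat.cast_pos.2 (hk n hn1)
  rw [EReal.coe_lt_coe_iff, div_lt_iff₀ (by exact_mod_cast hn1)] at hn
  rw [← Real.log_le_iff_le_exp hk0]
  linarith

/-! ### Union bounds over blocks; uniform convergence for supercritical growth. -/

section

variable {Ω E : Type*} [MeasurableSpace Ω] [MeasurableSpace E] {P : Measure Ω} {X : ℕ → Ω → E}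
  {d : ℕ} {S : ℕ → (ℕ → E) → EuclideanSpace ℝ (Fin d)} {k : ℕ → ℕ}

theorem measure_exists_block_le (hXm : ∀ i, Measurable (X i)) (hX : Stationary P X) {n : ℕ}
    (hS : Measurable (S n)) {B : Set (EuclideanSpace ℝ (Fin d))} (hB : MeasurableSet B) :
    P {ω | ∃ j < k n, blockAvg S n j (fun i => X i ω) ∈ B} ≤ k n * avgLaw P X S n B := by
  have h1 : ∀ j, P {ω | blockAvg S n j (fun i => X i ω) ∈ B} = avgLaw P X S n B := by
    intro j
    have := lintegral_blockAvg (P := P) hXm hX hS (f := B.indicator 1)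
      (measurable_one.indicator hB) j
    rw [lintegral_indicator_one hB] at this
    rw [← this]
    exact (lintegral_indicator_one (measurable_blockAvg hXm hS j hB)).symm
  have h2 : {ω | ∃ j < k n, blockAvg S n j (fun i => X i ω) ∈ B} =
      ⋃ j ∈ Finset.range (k n), {ω | blockAvg S n j (fun i => X i ω) ∈ B} := by
    ext ω
    simp
  rw [h2]
  refine (measure_biUnion_finset_le _ _).trans (le_of_eq ?_)
  simp [h1]

/-- If the expected number of blocks with average in `B n` is exponentially small then almost
surely there is eventually no such block. -/
theorem ae_eventually_forall_block_notMem (hXm : ∀ i, Measurable (X i)) (hX : Stationary P X)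
    (hS : ∀ n, 1 ≤ n → Measurable (S n)) {B : Set (EuclideanSpace ℝ (Fin d))}
    (hB : MeasurableSet B) {κ b : ℝ} (hkκ : ∀ᶠ n : ℕ in atTop, (k n : ℝ) ≤ Real.exp (n * κ))
    (hb : ∀ᶠ n : ℕ in atTop, avgLaw P X S n B ≤ ENNReal.ofReal (Real.exp (n * b)))
    (hκb : κ + b < 0) :
    ∀ᵐ ω ∂P, ∀ᶠ n : ℕ in atTop, ∀ j < k n, blockAvg S n j (fun i => X i ω) ∉ B := by
  have := ae_eventually_notMem_of_exp (P := P) (C := 1) (η := -(κ + b)) (by linarith)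
    (s := fun n => {ω | ∃ j < k n, blockAvg S n j (fun i => X i ω) ∈ B}) (by
      filter_upwards [hkκ, hb, eventually_ge_atTop 1] with n h1 h2 hn
      refine (measure_exists_block_le hXm hX (hS n hn) hB).trans ((mul_le_mul_right h2 _).trans ?_)
      rw [← ENNReal.ofReal_natCast, ← ENNReal.ofReal_mul (Nat.cast_nonneg _)]
      refine ENNReal.ofReal_le_ofReal ((mul_le_mul_of_nonneg_right h1 (Real.exp_pos _).le).trans
        (le_of_eq ?_))
      rw [← Real.exp_add, one_mul]
      congr 1
      ring)
  filter_upwards [this] with ω hω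
  filter_upwards [hω] with n hn j hj hjB
  exact hn ⟨j, hj, hjB⟩

variable [IsProbabilityMeasure P]

/-- Above the critical growth of `k`, the empirical `logMGF` converges uniformly near `l₀`. -/
theorem exists_ae_tendstoUniformlyOn (hXm : ∀ i, Measurable (X i)) (hX : Stationary P X)
    (hS : ∀ n, 1 ≤ n → Measurable (S n)) (hk : ∀ n, 1 ≤ n → 1 ≤ k n)
    (hA2 : MixingMoments P X) (hA3 : BlockApproximable S)
    {f : EuclideanSpace ℝ (Fin d) → ℝ} {D : Set (EuclideanSpace ℝ (Fin d))} (hDopen : IsOpen D)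
    (hDconv : Convex ℝ D)
    (hlim : ∀ l ∈ D, Tendsto (fun n => logMGF n (avgLaw P X S n) l) atTop (𝓝 (f l : EReal)))
    {l₀ x₀ : EuclideanSpace ℝ (Fin d)} (hl₀ : l₀ ∈ D) (hf : HasGradientAt f x₀ l₀) {κ : ℝ}
    (hκ : inner ℝ l₀ x₀ - f l₀ < κ) (hkκ : ∀ᶠ n : ℕ in atTop, Real.exp (n * κ) ≤ k n) :
    ∃ r : ℝ, 0 < r ∧ Metric.closedBall l₀ r ⊆ D ∧ ∀ᵐ ω ∂P, TendstoUniformlyOn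
      (fun n l => (logMGF n (empLaw S k n fun i => X i ω) l).toReal) f atTop
      (Metric.closedBall l₀ r) := by
  have hfcont : ContinuousOn f D := (convexOn_of_tendsto_logMGF hDconv hlim).continuousOn hDopen
  have hcont : ∀ l ∈ D, ContinuousAt f l := fun l hl => hfcont.continuousAt (hDopen.mem_nhds hl)
  have hDl₀ : ∀ᶠ l in 𝓝 l₀, l ∈ D := hDopen.mem_nhds hl₀
  set γ := κ - (inner ℝ l₀ x₀ - f l₀) with hγ
  have hγ0 : 0 < γ := by linarith
  obtain ⟨h, hhD, hhle, hh⟩ := (((tendsto_line l₀ l₀).eventually hDl₀).and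
    ((eventually_line_le hf l₀ (by positivity : 0 < γ / 4)).and self_mem_nhdsWithin)).exists
  replace hh : 0 < h := hh
  have hsm : l₀ + h • l₀ = (1 + h) • l₀ := by module
  rw [hsm] at hhD hhle
  -- At `l₀` this level satisfies both conditions of the law of large numbers strictly, with room `h
  -- γ / 4` and `γ / 2`. By continuity of `f` they persist, for the same `h` and `b`, at all tilts
  -- near `l₀`.
  set b := inner ℝ l₀ x₀ + γ / 2 with hb
  have hcont1 : ContinuousAt (fun l : EuclideanSpace ℝ (Fin d) => (1 + h) • l) l₀ := by fun_prop
  have hcont2 : ContinuousAt (fun l => f ((1 + h) • l)) l₀ :=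
    ContinuousAt.comp (f := fun l : EuclideanSpace ℝ (Fin d) => (1 + h) • l) (g := f)
      (hcont _ hhD) hcont1
  have hU : ∀ᶠ l in 𝓝 l₀, l ∈ D ∧ (1 + h) • l ∈ D ∧ f ((1 + h) • l) < f l + h * b ∧
      b - f l < κ := by
    refine hDl₀.and ((hcont1.eventually (hDopen.mem_nhds hhD)).and
      ((hcont2.eventually_lt ((hcont _ hl₀).add continuousAt_const) ?_).and
      ((continuousAt_const.sub (hcont _ hl₀)).eventually_lt continuousAt_const ?_)))
    · have : h * (γ / 4) < h * (γ / 2) := by gcongr; linarith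
      simp only [Pi.add_apply, hb]
      linarith
    · simp only [Pi.sub_apply]
      linarith
  obtain ⟨R, hR, hRU⟩ := Metric.eventually_nhds_iff_ball.1 hU
  obtain ⟨B, hB, hBR⟩ := exists_mem_interior_convexHull_affineBasis (Metric.ball_mem_nhds l₀ hR)
  obtain ⟨r', hr', hr'B⟩ := Metric.isOpen_iff.1 isOpen_interior l₀ hB
  set r := r' / 3 with hr
  have hr0 : 0 < r := by positivity
  have hball : Metric.ball l₀ (3 * r) ⊆ convexHull ℝ (Set.range B) := by
    have : 3 * r = r' := by rw [hr]; ring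
    rw [this]
    exact hr'B.trans interior_subset
  have hball2 : Metric.ball l₀ (2 * r) ⊆ Metric.ball l₀ R :=
    (Metric.ball_subset_ball (by linarith)).trans (hball.trans hBR)
  -- The simplex vertices and centre give the uniform bound, the dense sequence gives the limit;
  -- countability allows one common null set.
  set Q : Set (EuclideanSpace ℝ (Fin d)) := Set.range B ∪ ({l₀} ∪
    Metric.ball l₀ R ∩ Set.range (TopologicalSpace.denseSeq (EuclideanSpace ℝ (Fin d)))) with hQ
  have hQc : Q.Countable := (Set.countable_range _).union ((Set.countable_singleton _).union
    ((Set.countable_range _).mono Set.inter_subset_right))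
  have hQR : Q ⊆ Metric.ball l₀ R := by
    refine Set.union_subset ((subset_convexHull ℝ _).trans hBR) (Set.union_subset ?_
      Set.inter_subset_left)
    simpa using hR
  refine ⟨r, hr0, fun l hl => (hRU l (hball2 (Metric.closedBall_subset_ball (by linarith) hl))).1,
    ?_⟩
  have hae : ∀ᵐ ω ∂P, ∀ q ∈ Q, Tendsto (fun n => logMGF n (empLaw S k n fun i => X i ω) q) atTop
      (𝓝 (f q : EReal)) := by
    rw [ae_ball_iff hQc]
    intro q hq
    obtain ⟨h1, h2, h3, h4⟩ := hRU q (hQR hq)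
    exact ae_tendsto_logMGF_empLaw hXm hX hS hk hA2 hA3 hh (hlim q h1) (hlim _ h2) h3 h4 hkκ
  filter_upwards [hae] with ω hω
  refine tendstoUniformlyOn_closedBall_of_convexOn (Q := Q) (T := Set.range B) hr0 ?_
    (hfcont.mono fun l hl => (hRU l (hball2 hl)).1) (Set.finite_range _) Set.subset_union_left hball
    (Or.inr (Or.inl rfl)) ?_ fun q hq => ?_
  · filter_upwards [eventually_ge_atTop 1] with n hn
    exact convexOn_logMGF_empLaw S hn (hk n hn) _
  · refine hball2.trans (((TopologicalSpace.denseRange_denseSeq _).open_subset_closure_inter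
      Metric.isOpen_ball).trans (closure_mono ?_))
    exact fun l hl => Or.inr (Or.inr hl)
  · have := (EReal.tendsto_toReal (EReal.coe_ne_top (f q)) (EReal.coe_ne_bot (f q))).comp (hω q hq)
    simpa [Function.comp_def] using this

end

/-- Local large deviations of measures whose `logMGF` converges near `l₀`. -/
theorem tendsto_liminf_limsup_expRate_closedBall {d : ℕ}
    {ν : ℕ → Measure (EuclideanSpace ℝ (Fin d))} {f : EuclideanSpace ℝ (Fin d) → ℝ}
    {l₀ x₀ : EuclideanSpace ℝ (Fin d)}
    (hlim : ∀ᶠ l in 𝓝 l₀, Tendsto (fun n => logMGF n (ν n) l) atTop (𝓝 (f l : EReal)))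
    (hf : HasGradientAt f x₀ l₀) :
    Tendsto (fun ε : ℝ => liminf (fun n => expRate n (ν n (Metric.closedBall x₀ ε))) atTop)
      (𝓝[>] 0) (𝓝 ((-(inner ℝ l₀ x₀ - f l₀) : ℝ) : EReal)) ∧
    Tendsto (fun ε : ℝ => limsup (fun n => expRate n (ν n (Metric.closedBall x₀ ε))) atTop)
      (𝓝[>] 0) (𝓝 ((-(inner ℝ l₀ x₀ - f l₀) : ℝ) : EReal)) := by
  set v := -(inner ℝ l₀ x₀ - f l₀) with hv
  have key : ∀ δ : ℝ, 0 < δ → ∀ᶠ ε : ℝ in 𝓝[>] 0,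
      ((v - δ : ℝ) : EReal) ≤ liminf (fun n => expRate n (ν n (Metric.closedBall x₀ ε))) atTop ∧
      limsup (fun n => expRate n (ν n (Metric.closedBall x₀ ε))) atTop ≤ ((v + δ : ℝ) : EReal) := by
    intro δ hδ
    have hcont : Tendsto (fun ε : ℝ => ε * ‖l₀‖) (𝓝[>] 0) (𝓝 0) := by
      have : Continuous fun ε : ℝ => ε * ‖l₀‖ := by fun_prop
      simpa using this.continuousAt.tendsto.mono_left (nhdsWithin_le_nhds (a := (0 : ℝ)))
    filter_upwards [hcont.eventually (gt_mem_nhds (half_pos hδ)), self_mem_nhdsWithin]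
      with ε hε (hε0 : 0 < ε)
    constructor
    · refine le_liminf_of_le (by isBoundedDefault) ?_
      filter_upwards [eventually_le_measure_closedBall hlim hf hε0 (half_pos hδ),
        eventually_gt_atTop 0] with n hn hn0
      rw [le_expRate_iff hn0]
      refine le_trans (ENNReal.ofReal_le_ofReal (Real.exp_le_exp.2 ?_)) hn
      exact mul_le_mul_of_nonneg_left (by linarith) (Nat.cast_nonneg n)
    · refine limsup_le_of_le (by isBoundedDefault) ?_
      filter_upwards [eventually_measure_closedBall_le hlim.self_of_nhds ε (half_pos hδ),
        eventually_gt_atTop 0] with n hn hn0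
      rw [expRate_le_iff hn0]
      refine le_trans hn (ENNReal.ofReal_le_ofReal (Real.exp_le_exp.2 ?_))
      exact mul_le_mul_of_nonneg_left (by linarith) (Nat.cast_nonneg n)
  have hle : ∀ ε : ℝ, liminf (fun n => expRate n (ν n (Metric.closedBall x₀ ε))) atTop ≤
      limsup (fun n => expRate n (ν n (Metric.closedBall x₀ ε))) atTop := fun ε =>
    liminf_le_limsup
  constructor
  · exact ereal_tendsto_coe_iff.2 fun δ hδ => ⟨(key δ hδ).mono fun ε h => h.1,
      (key δ hδ).mono fun ε h => (hle ε).trans h.2⟩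
  · exact ereal_tendsto_coe_iff.2 fun δ hδ => ⟨(key δ hδ).mono fun ε h => h.1.trans (hle ε),
      (key δ hδ).mono fun ε h => h.2⟩

/-- The slope of a strictly supporting line at a point of differentiability is the derivative. -/
theorem StrictlyConvexAt.lt_of_hasGradientAt {d : ℕ} {L : EuclideanSpace ℝ (Fin d) → EReal}
    {f : EuclideanSpace ℝ (Fin d) → ℝ} {l₀ x₀ : EuclideanSpace ℝ (Fin d)}
    (hL : ∀ᶠ l in 𝓝 l₀, L l = f l) (hf : HasGradientAt f x₀ l₀)
    (h : StrictlyConvexAt (fun t => L (t • l₀)) 1) {t : ℝ} (ht : 0 ≤ t) (ht1 : t ≠ 1) :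
    ((f l₀ + inner ℝ l₀ x₀ * (t - 1) : ℝ) : EReal) < L (t • l₀) := by
  obtain ⟨m, hm⟩ := h
  simp only [one_smul, hL.self_of_nhds, ← EReal.coe_add] at hm
  suffices m = inner ℝ l₀ x₀ by rw [← this]; exact hm t ht ht1
  refine le_antisymm (le_of_forall_pos_le_add fun ρ hρ => ?_)
    (le_of_forall_pos_le_add fun ρ hρ => ?_)
  · obtain ⟨u, hu1, hu2, hu⟩ := (((tendsto_line l₀ l₀).eventually hL).and
      ((eventually_line_le hf l₀ hρ).and self_mem_nhdsWithin)).exists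
    replace hu : 0 < u := hu
    have hsm : l₀ + u • l₀ = (1 + u) • l₀ := by module
    rw [hsm] at hu1 hu2
    have h1 := hm (1 + u) (by linarith) (by linarith)
    rw [hu1, EReal.coe_lt_coe_iff] at h1
    have h2 : u * m < u * (inner ℝ l₀ x₀ + ρ) := by linarith
    exact (lt_of_mul_lt_mul_left h2 hu.le).le
  · obtain ⟨u, hu1, hu2, hu, hu'⟩ := (((tendsto_line l₀ (-l₀)).eventually hL).and
      ((eventually_line_le hf (-l₀) hρ).and
      (Ioo_mem_nhdsGT (zero_lt_one (α := ℝ))))).exists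
    have hsm : l₀ + u • (-l₀) = (1 - u) • l₀ := by module
    rw [hsm] at hu1 hu2
    rw [inner_neg_left] at hu2
    have h1 := hm (1 - u) (by linarith) (by linarith)
    rw [hu1, EReal.coe_lt_coe_iff] at h1
    have h2 : u * inner ℝ l₀ x₀ < u * (m + ρ) := by linarith
    exact (lt_of_mul_lt_mul_left h2 hu.le).le

/-- Extrapolation of a convex function to the right of two points. -/
theorem ConvexOn.extrapolation_le {g : ℝ → ℝ} (hg : ConvexOn ℝ Set.univ g) {a v u t ρ θ : ℝ}
    (hu : 0 < u) (ht : 1 ≤ t) (h₁ : a - v * (u / 2) - θ ≤ g (1 - u / 2))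
    (h₂ : g (1 - u) ≤ a - u * v + ρ * u + θ) :
    a + (t - 1) * v - 2 * ρ * (t - 1 + u / 2) - 2 * θ / u * (2 * (t - 1) + 3 * u / 2) ≤ g t := by
  -- The hypotheses bound the chord slope over `[1 - u, 1 - u / 2]` below by `v - 2 ρ - 4 θ / u`;
  -- prolonging this chord to `t` gives the claim. Below, `1 - u / 2` is written as a convex
  -- combination of `1 - u` and `t`.
  have hts : 0 < t - (1 - u) := by linarith
  have hc := hg.2 (Set.mem_univ (1 - u)) (Set.mem_univ t)
    (div_nonneg (by linarith) hts.le : 0 ≤ (t - (1 - u / 2)) / (t - (1 - u)))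
    (div_nonneg (by linarith) hts.le : 0 ≤ (u / 2) / (t - (1 - u)))
    (by field_simp; ring)
  have hpt : ((t - (1 - u / 2)) / (t - (1 - u))) • (1 - u) + ((u / 2) / (t - (1 - u))) • t =
      1 - u / 2 := by
    rw [smul_eq_mul, smul_eq_mul]
    field_simp
    ring
  rw [hpt, smul_eq_mul, smul_eq_mul] at hc
  have hc' : (t - (1 - u)) * g (1 - u / 2) ≤
      (t - (1 - u / 2)) * g (1 - u) + u / 2 * g t := by
    have := mul_le_mul_of_nonneg_left hc hts.le
    refine this.trans (le_of_eq ?_)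
    field_simp
  have h3 : (t - (1 - u)) * (a - v * (u / 2) - θ) ≤ (t - (1 - u)) * g (1 - u / 2) := by gcongr
  have h4 : (t - (1 - u / 2)) * g (1 - u) ≤ (t - (1 - u / 2)) * (a - u * v + ρ * u + θ) :=
    mul_le_mul_of_nonneg_left h₂ (by linarith)
  have h5 : u / 2 * (a + (t - 1) * v - 2 * ρ * (t - 1 + u / 2) -
      2 * θ / u * (2 * (t - 1) + 3 * u / 2)) ≤ u / 2 * g t := by
    have : u / 2 * (a + (t - 1) * v - 2 * ρ * (t - 1 + u / 2) -
        2 * θ / u * (2 * (t - 1) + 3 * u / 2)) = (t - (1 - u)) * (a - v * (u / 2) - θ) -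
        (t - (1 - u / 2)) * (a - u * v + ρ * u + θ) := by
      field_simp
      ring
    linarith
  exact le_of_mul_le_mul_left h5 (by positivity)

/-! ### Subcritical and critical growth. -/

section

variable {Ω E : Type*} [MeasurableSpace Ω] [MeasurableSpace E] {P : Measure Ω} {X : ℕ → Ω → E}
  {d : ℕ} {S : ℕ → (ℕ → E) → EuclideanSpace ℝ (Fin d)} {k : ℕ → ℕ}

/-- Below the critical growth of `k`, there are eventually no block averages near `x₀`. -/
theorem exists_ae_eventually_blocks_eq_empty (hXm : ∀ i, Measurable (X i)) (hX : Stationary P X)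
    (hS : ∀ n, 1 ≤ n → Measurable (S n)) {l₀ x₀ : EuclideanSpace ℝ (Fin d)} {a κ : ℝ}
    (ha : Tendsto (fun n => logMGF n (avgLaw P X S n) l₀) atTop (𝓝 (a : EReal)))
    (hκ : κ < inner ℝ l₀ x₀ - a) (hkκ : ∀ᶠ n : ℕ in atTop, (k n : ℝ) ≤ Real.exp (n * κ)) :
    ∃ ε : ℝ, 0 < ε ∧ ∀ᵐ ω ∂P, ∀ᶠ n : ℕ in atTop,
      {j : ℕ | j < k n ∧ blockAvg S n j (fun i => X i ω) ∈ Metric.closedBall x₀ ε} = ∅ := by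
  set γ := inner ℝ l₀ x₀ - a - κ with hγ
  have hγ0 : 0 < γ := by linarith
  -- The ball's radius and the convergence error each cost at most `γ / 4`, so the expected number
  -- of blocks in the ball still decays at rate `γ / 2`.
  set ε := γ / (4 * (‖l₀‖ + 1)) with hε
  have hεl : ε * ‖l₀‖ ≤ γ / 4 := by
    rw [hε, div_mul_eq_mul_div, div_le_iff₀ (by positivity)]
    nlinarith [norm_nonneg l₀]
  refine ⟨ε, by positivity, ?_⟩
  have := ae_eventually_forall_block_notMem hXm hX hS
    (Metric.isClosed_closedBall (x := x₀) (ε := ε)).measurableSet hkκ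
    (eventually_measure_closedBall_le ha ε (by positivity : 0 < γ / 4)) (by linarith)
  filter_upwards [this] with ω hω
  filter_upwards [hω] with n hn
  exact Set.eq_empty_of_forall_notMem fun j hj => hn j hj.1 hj.2

/-- At the critical growth of `k`, the block averages eventually lie below every hyperplane
above `x₀` orthogonal to `l₀`. -/
theorem ae_eventually_inner_block_lt (hXm : ∀ i, Measurable (X i)) (hX : Stationary P X)
    (hS : ∀ n, 1 ≤ n → Measurable (S n)) {f : EuclideanSpace ℝ (Fin d) → ℝ}
    {l₀ x₀ : EuclideanSpace ℝ (Fin d)}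
    (hlim : ∀ᶠ l in 𝓝 l₀,
      Tendsto (fun n => logMGF n (avgLaw P X S n) l) atTop (𝓝 (f l : EReal)))
    (hf : HasGradientAt f x₀ l₀)
    (hk : ∀ κ : ℝ, inner ℝ l₀ x₀ - f l₀ < κ → ∀ᶠ n : ℕ in atTop, (k n : ℝ) ≤ Real.exp (n * κ))
    {ε : ℝ} (hε : 0 < ε) :
    ∀ᵐ ω ∂P, ∀ᶠ n : ℕ in atTop, ∀ j < k n,
      inner ℝ l₀ (blockAvg S n j (fun i => X i ω)) < inner ℝ l₀ x₀ + ε := by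
  obtain ⟨h, hlimh, hle, hh⟩ := (((tendsto_line l₀ l₀).eventually hlim).and
    ((eventually_line_le hf l₀ (half_pos hε)).and self_mem_nhdsWithin)).exists
  replace hh : 0 < h := hh
  set b := inner ℝ l₀ x₀ + ε with hb
  have hmeas : MeasurableSet {x : EuclideanSpace ℝ (Fin d) | b ≤ inner ℝ l₀ x} :=
    measurableSet_le measurable_const (by fun_prop)
  -- Chernoff at the tilt `(1 + h) l₀`: the rates of the half-space and of the block count add up to
  -- at most `-(1 + h) ε / 2`.
  have := ae_eventually_forall_block_notMem (k := k) hXm hX hS hmeas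
    (κ := inner ℝ l₀ x₀ - f l₀ + ε / 4) (b := f (l₀ + h • l₀) + ε / 4 - (1 + h) * b)
    (hk _ (by linarith)) (by
      filter_upwards [(expRate_tendsto_iff.1 hlimh (ε / 4) (by positivity)).2] with n hn
      refine (measure_halfspace_le _ n (l₀ + h • l₀) (b := (1 + h) * b) fun x hx => ?_).trans
        ((mul_le_mul_right hn _).trans (le_of_eq ?_))
      · have hx' : b ≤ inner ℝ l₀ x := hx
        rw [inner_add_left, real_inner_smul_left]
        nlinarith
      · rw [← ENNReal.ofReal_mul (Real.exp_pos _).le, ← Real.exp_add]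
        congr 2
        ring) (by rw [hb]; nlinarith)
  filter_upwards [this] with ω hω
  filter_upwards [hω] with n hn j hj
  exact not_le.1 (hn j hj)

theorem lintegral_empLaw_smul_le {E : Type*} (S : ℕ → (ℕ → E) → EuclideanSpace ℝ (Fin d))
    {n : ℕ} (x : ℕ → E) {l : EuclideanSpace ℝ (Fin d)} {b t : ℝ} (ht : 1 ≤ t)
    (hb : ∀ j < k n, inner ℝ l (blockAvg S n j x) ≤ b) :
    ∫⁻ y, ENNReal.ofReal (Real.exp (n * inner ℝ (t • l) y)) ∂(empLaw S k n x) ≤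
      ENNReal.ofReal (Real.exp (n * ((t - 1) * b))) *
        ∫⁻ y, ENNReal.ofReal (Real.exp (n * inner ℝ l y)) ∂(empLaw S k n x) := by
  rw [lintegral_empLaw, lintegral_empLaw, mul_left_comm,
    Finset.mul_sum _ _ (ENNReal.ofReal (Real.exp (n * ((t - 1) * b))))]
  refine mul_le_mul' le_rfl (Finset.sum_le_sum fun j hj => ?_)
  rw [← ENNReal.ofReal_mul (Real.exp_pos _).le, ← Real.exp_add, ← mul_add,
    real_inner_smul_left]
  refine ENNReal.ofReal_le_ofReal (Real.exp_le_exp.2 ?_)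
  gcongr
  have := mul_le_mul_of_nonneg_left (hb j (Finset.mem_range.1 hj)) (by linarith : 0 ≤ t - 1)
  linarith

variable [IsProbabilityMeasure P]

/-- At the critical growth of `k`, the law of large numbers holds for tilts `s • l₀`, `s < 1`,
where the tangent at `l₀` is strictly below the limiting `logMGF`. -/
theorem ae_tendsto_logMGF_empLaw_smul (hXm : ∀ i, Measurable (X i)) (hX : Stationary P X)
    (hS : ∀ n, 1 ≤ n → Measurable (S n)) (hk : ∀ n, 1 ≤ n → 1 ≤ k n)
    (hA2 : MixingMoments P X) (hA3 : BlockApproximable S)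
    {l₀ : EuclideanSpace ℝ (Fin d)} {a c s v : ℝ} (hs0 : 0 < s) (hs1 : s < 1)
    (hlim₀ : Tendsto (fun n => logMGF n (avgLaw P X S n) l₀) atTop (𝓝 (a : EReal)))
    (hlim : Tendsto (fun n => logMGF n (avgLaw P X S n) (s • l₀)) atTop (𝓝 (c : EReal)))
    (hc : a + v * (s - 1) < c)
    (hkκ : ∀ κ : ℝ, κ < v - a → ∀ᶠ n : ℕ in atTop, Real.exp (n * κ) ≤ k n) :
    ∀ᵐ ω ∂P, Tendsto (fun n => logMGF n (empLaw S k n fun i => X i ω) (s • l₀)) atTop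
      (𝓝 (c : EReal)) := by
  have hs1' : 0 < 1 - s := by linarith
  have hsm : (1 + (1 - s) / s) • s • l₀ = l₀ := by
    rw [smul_smul]
    have : (1 + (1 - s) / s) * s = 1 := by field_simp; ring
    rw [this, one_smul]
  -- The law of large numbers is applied at `s • l₀` with `h = (1 - s) / s`, so its upper tilt is
  -- `l₀` itself. The admissible truncation levels lie between these two numbers, and the interval
  -- is nonempty exactly when the tangent is strictly below `c`.
  have hlt : s * (a - c) / (1 - s) < v - a + c := by
    rw [div_lt_iff₀ hs1']
    nlinarith
  obtain ⟨b, hb1, hb2⟩ := exists_between hlt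
  obtain ⟨κ, hκ1, hκ2⟩ := exists_between (sub_left_lt_of_lt_add (by linarith) : b - c < v - a)
  refine ae_tendsto_logMGF_empLaw hXm hX hS hk hA2 hA3 (h := (1 - s) / s) (b := b) (κ := κ)
    (by positivity) hlim (by rw [hsm]; exact hlim₀) ?_ hκ1 (hkκ κ hκ2)
  rw [div_lt_iff₀ hs1'] at hb1
  rw [div_mul_eq_mul_div, ← sub_lt_iff_lt_add', lt_div_iff₀ hs0]
  linarith

/-- At the critical growth of `k`, the empirical `logMGF` is asymptotically linear along the ray
through `l₀` beyond `l₀`. -/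
theorem ae_tendsto_logMGF_empLaw_linear (hXm : ∀ i, Measurable (X i)) (hX : Stationary P X)
    (hS : ∀ n, 1 ≤ n → Measurable (S n)) (hk : ∀ n, 1 ≤ n → 1 ≤ k n)
    (hA2 : MixingMoments P X) (hA3 : BlockApproximable S)
    {f : EuclideanSpace ℝ (Fin d) → ℝ} {l₀ x₀ : EuclideanSpace ℝ (Fin d)}
    (hlim : ∀ᶠ l in 𝓝 l₀,
      Tendsto (fun n => logMGF n (avgLaw P X S n) l) atTop (𝓝 (f l : EReal)))
    (hf : HasGradientAt f x₀ l₀)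
    (hstrict : ∀ᶠ s : ℝ in 𝓝[>] 0, f l₀ - inner ℝ l₀ x₀ * s < f ((1 - s) • l₀))
    (hklow : ∀ κ : ℝ, κ < inner ℝ l₀ x₀ - f l₀ →
      ∀ᶠ n : ℕ in atTop, Real.exp (n * κ) ≤ k n)
    (hkup : ∀ κ : ℝ, inner ℝ l₀ x₀ - f l₀ < κ →
      ∀ᶠ n : ℕ in atTop, (k n : ℝ) ≤ Real.exp (n * κ)) :
    ∀ᵐ ω ∂P, ∀ t : ℝ, 1 ≤ t →
      Tendsto (fun n => logMGF n (empLaw S k n fun i => X i ω) (t • l₀)) atTop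
        (𝓝 ((f l₀ + (t - 1) * inner ℝ l₀ x₀ : ℝ) : EReal)) := by
  set v : ℝ := inner ℝ l₀ x₀ with hv
  have hsm : ∀ u : ℝ, l₀ + u • (-l₀) = (1 - u) • l₀ := fun u => by module
  have hlim' : ∀ᶠ u : ℝ in 𝓝[>] 0, Tendsto (fun n => logMGF n (avgLaw P X S n) ((1 - u) • l₀))
      atTop (𝓝 (f ((1 - u) • l₀) : EReal)) := by
    filter_upwards [(tendsto_line l₀ (-l₀)).eventually hlim] with u hu
    rwa [hsm] at hu
  obtain ⟨u₀, hu₀, hu₀'⟩ := mem_nhdsGT_iff_exists_Ioo_subset.1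
    (hlim'.and (hstrict.and (Ioo_mem_nhdsGT (zero_lt_one (α := ℝ)))))
  replace hu₀ : 0 < u₀ := hu₀
  have hlower : ∀ m : ℕ, ∀ᵐ ω ∂P, (1 / (m + 1) : ℝ) < u₀ →
      Tendsto (fun n => logMGF n (empLaw S k n fun i => X i ω) ((1 - 1 / (m + 1) : ℝ) • l₀)) atTop
        (𝓝 (f ((1 - 1 / (m + 1) : ℝ) • l₀) : EReal)) := by
    intro m
    by_cases hm : (1 / (m + 1) : ℝ) < u₀
    · obtain ⟨h1, h2, h3⟩ := hu₀' (show (1 / (m + 1) : ℝ) ∈ Set.Ioo 0 u₀ from ⟨by positivity, hm⟩)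
      have := ae_tendsto_logMGF_empLaw_smul hXm hX hS hk hA2 hA3 (v := v) (by linarith [h3.2])
        (by linarith [h3.1]) hlim.self_of_nhds h1 (by linarith) hklow
      filter_upwards [this] with ω hω _ using hω
    · exact Eventually.of_forall fun ω h => absurd h hm
  have hupper : ∀ m : ℕ, ∀ᵐ ω ∂P, ∀ᶠ n : ℕ in atTop, ∀ j < k n,
      inner ℝ l₀ (blockAvg S n j (fun i => X i ω)) < v + 1 / (m + 1) := fun m =>
    ae_eventually_inner_block_lt hXm hX hS hlim hf hkup (by positivity)
  filter_upwards [ae_all_iff.2 hlower, ae_all_iff.2 hupper,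
    ae_eventually_lintegral_empLaw_le hXm hX hS hk hlim.self_of_nhds] with ω h1 h2 h3 t ht
  rw [ereal_tendsto_coe_iff]
  intro δ hδ
  have ht0 : 0 < t := by linarith
  constructor
  -- The slope error `ρ`, and the convergence error `θ` chosen once `u` is fixed, each cost at most
  -- `δ / 2` in the extrapolation.
  · set ρ := δ / (4 * t) with hρ
    have hρ0 : 0 < ρ := by positivity
    obtain ⟨u₁, hu₁, hu₁'⟩ := mem_nhdsGT_iff_exists_Ioo_subset.1 (eventually_line_le hf (-l₀) hρ0)
    obtain ⟨m, hm⟩ := exists_nat_one_div_lt (lt_min hu₀ hu₁)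
    set u : ℝ := 1 / (m + 1) with hu
    have hu0 : 0 < u := by positivity
    have hum : u < u₀ := hm.trans_le (min_le_left _ _)
    have hu1 : u < 1 := (hu₀' (show u ∈ Set.Ioo 0 u₀ from ⟨hu0, hum⟩)).2.2.2
    -- Both `u` and `u / 2` are of the form `1 / (m + 1)`, so the countable family of almost sure
    -- limits covers the two points of the chord.
    have hu2 : (1 / ((2 * m + 1 : ℕ) + 1) : ℝ) = u / 2 := by
      rw [hu]; push_cast; field_simp; ring
    have hfu : f ((1 - u) • l₀) ≤ f l₀ + u * (-v + ρ) := by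
      have := hu₁' (show u ∈ Set.Ioo 0 u₁ from ⟨hu0, hm.trans_le (min_le_right _ _)⟩)
      rwa [Set.mem_ofPred_eq, hsm, inner_neg_left] at this
    have hfu2 : f l₀ - v * (u / 2) < f ((1 - u / 2) • l₀) :=
      (hu₀' (show u / 2 ∈ Set.Ioo 0 u₀ from ⟨by positivity, by linarith⟩)).2.1
    set θ := δ * u / (8 * t) with hθ
    have hθ0 : 0 < θ := by positivity
    have hT1 := (ereal_tendsto_coe_iff.1 (h1 m hum) θ hθ0).2
    have hT2 := (ereal_tendsto_coe_iff.1 (h1 (2 * m + 1) (by rw [hu2]; linarith)) θ hθ0).1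
    rw [hu2] at hT2
    filter_upwards [hT1, hT2, eventually_ge_atTop 1] with n hn1 hn2 hn
    have hk0 : 0 < k n := hk n hn
    rw [← coe_toReal_logMGF_empLaw S hk0, EReal.coe_le_coe_iff] at hn1 hn2 ⊢
    have hconv : ConvexOn ℝ Set.univ fun t : ℝ =>
        (logMGF n (empLaw S k n fun i => X i ω) (t • l₀)).toReal :=
      (convexOn_logMGF_empLaw S hn hk0 _).comp_linearMap
        (LinearMap.toSpanSingleton ℝ (EuclideanSpace ℝ (Fin d)) l₀)
    have := ConvexOn.extrapolation_le hconv (a := f l₀) (v := v) (ρ := ρ) (θ := θ) hu0 ht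
      (by linarith) (by linarith)
    refine le_trans ?_ this
    have e1 : 2 * ρ * (t - 1 + u / 2) ≤ 2 * ρ * t :=
      mul_le_mul_of_nonneg_left (by linarith) (by positivity)
    have e2 : 2 * θ / u * (2 * (t - 1) + 3 * u / 2) ≤ 2 * θ / u * (2 * t) :=
      mul_le_mul_of_nonneg_left (by linarith) (by positivity)
    have e3 : 2 * ρ * t = δ / 2 := by rw [hρ]; field_simp; norm_num
    have e4 : 2 * θ / u * (2 * t) = δ / 2 := by rw [hθ]; field_simp; norm_num
    linarith
  -- With every `⟨l₀, x⟩` at most `v + 1/(m+1)`, passing from `l₀` to `t • l₀` adds at most `(t - 1)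
  -- (v + 1/(m+1))` to the rate.
  · obtain ⟨m, hm⟩ := exists_nat_one_div_lt (by positivity : 0 < δ / (2 * t))
    filter_upwards [h2 m, h3 (δ / 2) (by positivity), eventually_gt_atTop 0] with n hn1 hn2 hn
    rw [logMGF_eq_expRate, expRate_le_iff hn]
    refine (lintegral_empLaw_smul_le S _ ht fun j hj => (hn1 j hj).le).trans
      ((mul_le_mul_right hn2 _).trans ?_)
    rw [← ENNReal.ofReal_mul (Real.exp_pos _).le, ← Real.exp_add, ← mul_add]
    refine ENNReal.ofReal_le_ofReal (Real.exp_le_exp.2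
      (mul_le_mul_of_nonneg_left ?_ (Nat.cast_nonneg n)))
    have : (t - 1) * (1 / (m + 1)) ≤ δ / 2 := by
      calc (t - 1) * (1 / (m + 1)) ≤ t * (δ / (2 * t)) := by
            gcongr
            linarith
        _ = δ / 2 := by field_simp
    linarith

end

end LocalLDP

theorem theorem2p3 {Ω E : Type*} [MeasurableSpace Ω] [MeasurableSpace E]
    (P : Measure Ω) [IsProbabilityMeasure P] {d : ℕ}
    (X : ℕ → Ω → E) (hXm : ∀ i, Measurable (X i)) (hX : LocalLDP.Stationary P X)
    (S : ℕ → (ℕ → E) → EuclideanSpace ℝ (Fin d)) (hS : ∀ n, 1 ≤ n → Measurable (S n))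
    (k : ℕ → ℕ) (hk : ∀ n, 1 ≤ n → 1 ≤ k n) (hkmono : MonotoneOn k (Set.Ici 1))
    (Λ : EuclideanSpace ℝ (Fin d) → EReal)
    (hΛ : Λ = LocalLDP.limLogMGF (LocalLDP.avgLaw P X S))
    (D : Set (EuclideanSpace ℝ (Fin d))) (hDopen : IsOpen D) (hDconv : Convex ℝ D)
    (hA1 : ∀ l ∈ D, ∃ c : ℝ,
      Tendsto (fun n => LocalLDP.logMGF n (LocalLDP.avgLaw P X S n) l) atTop (𝓝 (c : EReal)))
    (hA2 : LocalLDP.MixingMoments P X)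
    (hA3 : LocalLDP.BlockApproximable S)
    (l₀ x₀ : EuclideanSpace ℝ (Fin d)) (hl₀ : l₀ ∈ interior D)
    (hgrad : HasGradientAt (fun l => (Λ l).toReal) x₀ l₀) :
    -- (1)
    (LocalLDP.legendre Λ x₀ < liminf (fun n : ℕ => ((Real.log (k n) / n : ℝ) : EReal)) atTop →
      ∃ r : ℝ, 0 < r ∧ Metric.closedBall l₀ r ⊆ D ∧
        ∀ᵐ ω ∂P, TendstoUniformlyOn
          (fun n l => (LocalLDP.logMGF n (LocalLDP.empLaw S k n (fun i => X i ω)) l).toReal)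
          (fun l => (Λ l).toReal) atTop (Metric.closedBall l₀ r)) ∧
    -- (2), supercritical case
    (LocalLDP.legendre Λ x₀ < liminf (fun n : ℕ => ((Real.log (k n) / n : ℝ) : EReal)) atTop →
      ∀ᵐ ω ∂P,
        Tendsto (fun ε : ℝ => liminf (fun n : ℕ => (((n : ℝ)⁻¹ : ℝ) : EReal) * ENNReal.log
            (LocalLDP.empLaw S k n (fun i => X i ω) (Metric.closedBall x₀ ε))) atTop)
          (𝓝[>] 0) (𝓝 (-LocalLDP.legendre Λ x₀)) ∧
        Tendsto (fun ε : ℝ => limsup (fun n : ℕ => (((n : ℝ)⁻¹ : ℝ) : EReal) * ENNReal.log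
            (LocalLDP.empLaw S k n (fun i => X i ω) (Metric.closedBall x₀ ε))) atTop)
          (𝓝[>] 0) (𝓝 (-LocalLDP.legendre Λ x₀))) ∧
    -- (2), subcritical case
    (limsup (fun n : ℕ => ((Real.log (k n) / n : ℝ) : EReal)) atTop < LocalLDP.legendre Λ x₀ →
      ∃ ε : ℝ, 0 < ε ∧ ∀ᵐ ω ∂P, ∀ᶠ n : ℕ in atTop,
        {j : ℕ | j < k n ∧
          LocalLDP.blockAvg S n j (fun i => X i ω) ∈ Metric.closedBall x₀ ε} = ∅) ∧
    -- (3)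
    (Tendsto (fun n : ℕ => ((Real.log (k n) / n : ℝ) : EReal)) atTop
        (𝓝 (LocalLDP.legendre Λ x₀)) →
      LocalLDP.StrictlyConvexAt (fun t => Λ (t • l₀)) 1 →
      ∀ᵐ ω ∂P, ∀ t : ℝ, 1 ≤ t →
        Tendsto (fun n => LocalLDP.logMGF n (LocalLDP.empLaw S k n (fun i => X i ω)) (t • l₀))
          atTop (𝓝 (Λ l₀ + (((t - 1) * inner ℝ l₀ x₀ : ℝ) : EReal)))) := by
  rw [hDopen.interior_eq] at hl₀
  set f : EuclideanSpace ℝ (Fin d) → ℝ := fun l => (Λ l).toReal with hf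
  -- `toReal` is faithful on `D`, where `Λ` is finite; outside `D`, where `Λ` may be infinite, only
  -- `Λ` itself is used.
  have hΛD : ∀ l ∈ D, Λ l = f l := by
    intro l hl
    obtain ⟨c, hc⟩ := hA1 l hl
    have : Λ l = c := by rw [hΛ]; exact hc.limsup_eq
    simp only [hf, this, EReal.toReal_coe]
  have hlim : ∀ l ∈ D, Tendsto (fun n => LocalLDP.logMGF n (LocalLDP.avgLaw P X S n) l) atTop
      (𝓝 (f l : EReal)) := by
    intro l hl
    obtain ⟨c, hc⟩ := hA1 l hl
    have : (f l : EReal) = c := by rw [← hΛD l hl, hΛ]; exact hc.limsup_eq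
    rwa [this]
  have hDnhds : ∀ᶠ l in 𝓝 l₀, l ∈ D := hDopen.mem_nhds hl₀
  have hlim₀ : ∀ᶠ l in 𝓝 l₀, Tendsto (fun n => LocalLDP.logMGF n (LocalLDP.avgLaw P X S n) l) atTop
      (𝓝 (f l : EReal)) := hDnhds.mono hlim
  have hleg : LocalLDP.legendre Λ x₀ = ((inner ℝ l₀ x₀ - f l₀ : ℝ) : EReal) :=
    LocalLDP.legendre_eq (hΛD l₀ hl₀) fun l => by
      rw [hΛ]
      exact LocalLDP.tangent_le_limLogMGF hlim₀ hgrad l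
  have hpart1 : LocalLDP.legendre Λ x₀ <
      liminf (fun n : ℕ => ((Real.log (k n) / n : ℝ) : EReal)) atTop →
      ∃ r : ℝ, 0 < r ∧ Metric.closedBall l₀ r ⊆ D ∧
        ∀ᵐ ω ∂P, TendstoUniformlyOn
          (fun n l => (LocalLDP.logMGF n (LocalLDP.empLaw S k n (fun i => X i ω)) l).toReal)
          (fun l => (Λ l).toReal) atTop (Metric.closedBall l₀ r) := by
    intro h
    obtain ⟨κ, hκ1, hκ2⟩ := EReal.lt_iff_exists_real_btwn.1 h
    rw [hleg, EReal.coe_lt_coe_iff] at hκ1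
    exact LocalLDP.exists_ae_tendstoUniformlyOn hXm hX hS hk hA2 hA3 hDopen hDconv hlim hl₀ hgrad
      hκ1 (LocalLDP.eventually_exp_le_of_lt_log_div hk (eventually_lt_of_lt_liminf hκ2))
  refine ⟨hpart1, fun h => ?_, fun h => ?_, fun h hstrict => ?_⟩
  · obtain ⟨r, hr, hrD, hae⟩ := hpart1 h
    filter_upwards [hae] with ω hω
    rw [hleg, ← EReal.coe_neg]
    -- For fixed `ω` the empirical laws have the same limit `f` near `l₀`, so the deterministic
    -- local result applies to them directly.
    refine LocalLDP.tendsto_liminf_limsup_expRate_closedBall (f := f) ?_ hgrad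
    filter_upwards [Metric.closedBall_mem_nhds l₀ hr] with l hl
    refine ((EReal.tendsto_coe.2 (hω.tendsto_at hl))).congr' ?_
    filter_upwards [eventually_ge_atTop 1] with n hn
    exact LocalLDP.coe_toReal_logMGF_empLaw S (hk n hn) _ l
  · obtain ⟨κ, hκ1, hκ2⟩ := EReal.lt_iff_exists_real_btwn.1 h
    rw [hleg, EReal.coe_lt_coe_iff] at hκ2
    exact LocalLDP.exists_ae_eventually_blocks_eq_empty hXm hX hS (hlim l₀ hl₀) hκ2
      (LocalLDP.eventually_le_exp_of_log_div_lt hk (eventually_lt_of_limsup_lt hκ1))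
  · rw [hleg] at h
    have hstrict' : ∀ᶠ s : ℝ in 𝓝[>] 0, f l₀ - inner ℝ l₀ x₀ * s < f ((1 - s) • l₀) := by
      filter_upwards [(LocalLDP.tendsto_line l₀ (-l₀)).eventually hDnhds,
        Ioo_mem_nhdsGT (zero_lt_one (α := ℝ))] with s hsD hs
      have hsm : l₀ + s • (-l₀) = (1 - s) • l₀ := by module
      rw [hsm] at hsD
      have := hstrict.lt_of_hasGradientAt (hDnhds.mono hΛD) hgrad (t := 1 - s) (by linarith [hs.2])
        (by linarith [hs.1])
      rw [hΛD _ hsD, EReal.coe_lt_coe_iff] at this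
      linarith
    have := LocalLDP.ae_tendsto_logMGF_empLaw_linear hXm hX hS hk hA2 hA3 hlim₀ hgrad hstrict'
      (fun κ hκ => LocalLDP.eventually_exp_le_of_lt_log_div hk
        (h.eventually (lt_mem_nhds (EReal.coe_lt_coe_iff.2 hκ))))
      (fun κ hκ => LocalLDP.eventually_le_exp_of_log_div_lt hk
        (h.eventually (gt_mem_nhds (EReal.coe_lt_coe_iff.2 hκ))))
    filter_upwards [this] with ω hω t ht
    rw [hΛD l₀ hl₀, ← EReal.coe_add]
    exact hω t ht
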